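/- **Definitions.** An Orlicz N-function is a continuous, even, convex $\varphi:\mathbb R\to\mathbb R$, increasing on $(0,\infty)$, with $\varphi(0)=0$, $\varphi(x)/x\to0$ as $x\to0$ and $\varphi(x)/x\to\infty$ as $x\to\infty$. It satisfies Condition Q if $\lim_{x\to0}\varphi(x)/x^2$ exists in $(0,+\infty]$. Its density is the non-decreasing, right-continuous function $f$ on $[0,\infty)$ with $f(0)=0$, $f(x)\to\infty$ as $x\to\infty$ and $\varphi(u)=\int_0^{|u|}f(v)\,dv$; its Young–Fenchel transform is $\varphi^*(x)=\sup_{y\in\mathbb R}(xy-\varphi(y))$. A zero mean random variable $\xi$ belongs to $Sub_\varphi(\Omega)$ if there is $a\ge0$ with $\mathbf E e^{\lambda\xi}\le e^{\varphi(a\lambda)}$ for all $\lambda\in\mathbb R$; its norm is $\tau_\varphi(\xi)=\sup_{\lambda\ne0}\varphi^{(-1)}(\ln\mathbf E e^{\lambda\xi})/|\lambda|$, where $\varphi^{(-1)}$ is the inverse of $\varphi$ on $[0,\infty)$. A process $X$ is $SSub_\varphi(\Omega)$ with determinative constant $C_X>0$ if all $X(t)\in Sub_\varphi(\Omega)$ and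 $\tau_\varphi\big(\sum_{i\in I}\lambda_iX(t_i)\big)\le C_X\big(\mathbf E(\sum_{i\in I}\lambda_iX(t_i))^2\big)^{1/2}$ for all finite $I$, all $t_i$ and all $\lambda_i\in\mathbb R$. **Theorem.** Let $\varphi$ be an Orlicz N-function satisfying Condition Q, with density $f$. Let $\omega>\Lambda>0$, $z\in(0,1)$, $T>0$, $p>0$, and let $n$ be an integer with $n\ge\frac{\omega t}{\pi\sqrt z}$ for all $t\in[0,T]$. Let $X(t)$, $t\in\mathbb R$, be a measurable real (wide-sense) stationary $SSub_\varphi(\Omega)$ process with mean zero and determinative constant $C_X$, whose spectrum is bandlimited to $[-\Lambda,\Lambda)$, that is, $$B(\tau):=\mathbf E X(t+\tau)X(t)=\int_{[-\Lambda,\Lambda)}e^{i\tau\lambda}\,dF(\lambda),\qquad t,\tau\in\mathbb R,$$ for a finite measure $F$. Put $$X_n(t)=\sum_{k=-n}^n\frac{\sin\left(\omega\left(t-\frac{k\pi}\omega\right)\right)}{\omega\left(t-\frac{k\pi}\omega\right)}\,X\!\left(\tfrac{k\pi}\omega\right)$$ (with the quotient equal to $1$ at $t=k\pi/\omega$), $$C_n(t)=B(0)\left(\frac{4\omega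 t}{\pi^2(1-z)}+\frac{4\left(z+1+\frac1n\right)}{\pi(1-z)^2\left(1-\frac\Lambda\omega\right)}\right)^2,\qquad S_{n,p}=\left(\frac{C_X}n\right)^p\int_0^TC_n(t)^{p/2}\,dt .$$ Then $\int_0^T|X(t)-X_n(t)|^p\,dt$ exists with probability $1$, and for every $\varepsilon>0$ with $\varepsilon>S_{n,p}\cdot\big(f\big(p\,(S_{n,p}/\varepsilon)^{1/p}\big)\big)^p$, $$\mathbf P\left\{\int_0^T|X(t)-X_n(t)|^p\,dt>\varepsilon\right\}\le2\exp\left\{-\varphi^*\left(\left(\varepsilon/S_{n,p}\right)^{1/p}\right)\right\}$$ (in the trivial case $S_{n,p}=0$, i.e. $B(0)=0$, the right-hand side is to be read as $2$). -/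

import Mathlib

open MeasureTheory ProbabilityTheory Filter Topology

/-- Orlicz N-functions. -/
structure IsOrliczNFunction (φ : ℝ → ℝ) : Prop where
  continuous : Continuous φ
  even : ∀ x, φ (-x) = φ x
  convex : ConvexOn ℝ Set.univ φ
  strictMonoOn : StrictMonoOn φ (Set.Ioi 0)
  map_zero : φ 0 = 0
  tendsto_div_zero : Tendsto (fun x => φ x / x) (𝓝[≠] 0) (𝓝 0)
  tendsto_div_atTop : Tendsto (fun x => φ x / x) atTop atTop

/-- Condition Q: `φ x / x ^ 2` has a limit in `(0, +∞]` as `x → 0`. -/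
def ConditionQ (φ : ℝ → ℝ) : Prop :=
  (∃ C : ℝ, 0 < C ∧ Tendsto (fun x => φ x / x ^ 2) (𝓝[≠] 0) (𝓝 C)) ∨
    Tendsto (fun x => φ x / x ^ 2) (𝓝[≠] 0) atTop

/-- The Young-Fenchel transform. For an Orlicz N-function the supremum is over a set that is
bounded above, since `φ y / |y| → ∞`. -/
noncomputable def youngFenchel (φ : ℝ → ℝ) (x : ℝ) : ℝ := ⨆ y : ℝ, (x * y - φ y)

/-- `f` is the density of the Orlicz N-function `φ`, i.e. `φ u = ∫ v in 0..|u|, f v` with `f`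
non-decreasing and right-continuous on `[0, ∞)`, `f 0 = 0` and `f x → ∞`.
These properties determine `f` on `[0, ∞)`: it is the right derivative of `φ` there. -/
structure IsDensity (φ f : ℝ → ℝ) : Prop where
  monotoneOn : MonotoneOn f (Set.Ici 0)
  rightContinuous : ∀ v, 0 ≤ v → ContinuousWithinAt f (Set.Ici v) v
  map_zero : f 0 = 0
  tendsto_atTop : Tendsto f atTop atTop
  eq_integral : ∀ u, φ u = ∫ v in (0 : ℝ)..|u|, f v

/-- Every Orlicz N-function has a density. -/
theorem IsOrliczNFunction.exists_isDensity {φ : ℝ → ℝ} (h : IsOrliczNFunction φ) :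
    ∃ f, IsDensity φ f := by
  have hd : ∀ x, HasDerivWithinAt φ (derivWithin φ (Set.Ioi x) x) (Set.Ioi x) x := fun x =>
    h.convex.hasDerivWithinAt_rightDeriv_of_mem_interior (by simp)
  have hmono : Monotone (fun x => derivWithin φ (Set.Ioi x) x) := by
    have := h.convex.monotoneOn_rightDeriv
    rw [interior_univ] at this
    exact fun x y hxy => this trivial trivial hxy
  have hsl : ∀ x y, x < y → derivWithin φ (Set.Ioi x) x ≤ slope φ x y := fun x y hxy =>
    h.convex.rightDeriv_le_slope_of_mem_interior (by simp) trivial hxy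
  have h0 : derivWithin φ (Set.Ioi 0) 0 = 0 := by
    have h1 := (hasDerivWithinAt_iff_tendsto_slope' (Set.self_notMem_Ioi)).mp (hd 0)
    have h2 : Tendsto (slope φ 0) (𝓝[>] 0) (𝓝 0) := by
      refine (h.tendsto_div_zero.mono_left (nhdsWithin_mono _ ?_)).congr ?_
      · intro x hx
        exact ne_of_gt hx
      · intro x
        simp [slope_def_field, h.map_zero]
    exact tendsto_nhds_unique h1 h2
  have heq : ∀ u, 0 ≤ u → φ u = ∫ v in (0 : ℝ)..u, derivWithin φ (Set.Ioi v) v := by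
    intro u hu
    rw [intervalIntegral.integral_eq_sub_of_hasDeriv_right_of_le hu h.continuous.continuousOn
      (fun x _ => hd x) hmono.intervalIntegrable, h.map_zero, sub_zero]
  refine ⟨fun x => derivWithin φ (Set.Ioi x) x, hmono.monotoneOn _, ?_, h0, ?_, ?_⟩
  · intro v _
    rw [Metric.continuousWithinAt_iff']
    intro e he
    have h1 := (hasDerivWithinAt_iff_tendsto_slope' (Set.self_notMem_Ioi)).mp (hd v)
    have h2 : ∀ᶠ u in 𝓝[>] v, slope φ v u < derivWithin φ (Set.Ioi v) v + e :=
      h1.eventually (gt_mem_nhds (by linarith))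
    obtain ⟨u, hu, hvu⟩ := (h2.and self_mem_nhdsWithin).exists
    have hvu' : v < u := hvu
    have h3 : ContinuousAt (fun y => slope φ y u) v := by
      simp only [slope_def_field]
      have hne : u - v ≠ 0 := by linarith
      have hc : ContinuousAt φ v := h.continuous.continuousAt
      fun_prop (disch := assumption)
    have h4 := h3.eventually (gt_mem_nhds hu)
    filter_upwards [mem_nhdsWithin_of_mem_nhds h4,
      mem_nhdsWithin_of_mem_nhds (Iio_mem_nhds hvu'), self_mem_nhdsWithin] with y hy1 hy2 hy3
    have h5 := hmono (show v ≤ y from hy3)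
    have h6 := hsl y u hy2
    simp only at h5
    rw [Real.dist_eq, abs_of_nonneg (by linarith)]
    linarith
  · refine tendsto_atTop_mono' _ ?_ h.tendsto_div_atTop
    filter_upwards [eventually_gt_atTop 0] with x hx
    rw [div_le_iff₀ hx, heq x hx.le]
    have h1 := intervalIntegral.integral_mono_on (μ := volume) hx.le hmono.intervalIntegrable
      (intervalIntegrable_const (c := derivWithin φ (Set.Ioi x) x))
      (fun y hy => hmono hy.2)
    simpa [mul_comm] using h1
  · intro u
    have habs : φ u = φ |u| := by
      rcases abs_choice u with hu | hu
      · rw [hu]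
      · rw [hu, h.even]
    rw [habs, heq _ (abs_nonneg u)]

section Processes

variable {Ω : Type*} [MeasurableSpace Ω]

/-- `ξ ∈ Sub_φ(Ω)`: a zero mean random variable, all of whose exponential moments are finite and
satisfy `E exp (l ξ) ≤ exp (φ (a l))` for some `a ≥ 0` and all real `l`. -/
def IsSub (φ : ℝ → ℝ) (P : Measure Ω) (ξ : Ω → ℝ) : Prop :=
  Integrable ξ P ∧ ∫ w, ξ w ∂P = 0 ∧
    ∃ a : ℝ, 0 ≤ a ∧ ∀ l : ℝ, Integrable (fun w => Real.exp (l * ξ w)) P ∧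
      ∫ w, Real.exp (l * ξ w) ∂P ≤ Real.exp (φ (a * l))

/-- The norm `τ_φ` of the space `Sub_φ(Ω)`. The inverse of `φ` is that of the bijection
`φ : [0, ∞) → [0, ∞)`; for `ξ ∈ Sub_φ(Ω)` the logarithm is non-negative and the supremum is
finite. -/
noncomputable def subNorm (φ : ℝ → ℝ) (P : Measure Ω) (ξ : Ω → ℝ) : ℝ :=
  ⨆ l : {l : ℝ // l ≠ 0},
    Function.invFunOn φ (Set.Ici 0) (Real.log (∫ w, Real.exp (l.1 * ξ w) ∂P)) / |l.1|

/-- `C` is a determinative constant of the family `X`. -/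
def IsDeterminativeConstant {ι : Type*} (φ : ℝ → ℝ) (P : Measure Ω) (X : ι → Ω → ℝ) (C : ℝ) :
    Prop :=
  0 < C ∧ ∀ (I : Finset ι) (c : ι → ℝ),
    subNorm φ P (fun w => ∑ i ∈ I, c i * X i w) ≤
      C * Real.sqrt (∫ w, (∑ i ∈ I, c i * X i w) ^ 2 ∂P)

/-- `X` is an `SSub_φ(Ω)` process with determinative constant `C`. -/
def IsSSubWith {ι : Type*} (φ : ℝ → ℝ) (P : Measure Ω) (X : ι → Ω → ℝ) (C : ℝ) : Prop :=
  (∀ t, IsSub φ P (X t)) ∧ IsDeterminativeConstant φ P X C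

/-- `B τ = E X(τ) X(0)`, the covariance function of a centred stationary process. -/
noncomputable def covFun (P : Measure Ω) (X : ℝ → Ω → ℝ) (τ : ℝ) : ℝ := ∫ w, X τ w * X 0 w ∂P

/-- Centred (wide-sense) stationary processes: square integrable, with mean zero, and with
`E X(t + τ) X(t)` depending on `τ` only. -/
def IsCentredStationary (P : Measure Ω) (X : ℝ → Ω → ℝ) : Prop :=
  (∀ t, MemLp (X t) 2 P) ∧ (∀ t, ∫ w, X t w ∂P = 0) ∧
    ∀ t τ, ∫ w, X (t + τ) w * X t w ∂P = covFun P X τ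

/-- The spectrum of the stationary process `X` is bandlimited to `[-Λ, Λ)`:
`B τ = ∫ exp (i τ l) dF(l)` for a finite measure `F` carried by `[-Λ, Λ)`. -/
def IsBandlimited (P : Measure Ω) (X : ℝ → Ω → ℝ) (Λ : ℝ) : Prop :=
  ∃ F : Measure ℝ, IsFiniteMeasure F ∧ F (Set.Ico (-Λ) Λ)ᶜ = 0 ∧
    ∀ τ : ℝ, (covFun P X τ : ℂ) = ∫ l : ℝ, Complex.exp (Complex.I * τ * l) ∂F

/-- The truncated Whittaker-Kotel'nikov-Shannon sum
`X_n(t) = ∑_{|k| ≤ n} sin (ω (t - k π / ω)) / (ω (t - k π / ω)) X(k π / ω)`. -/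
noncomputable def truncatedSum (X : ℝ → Ω → ℝ) (ω : ℝ) (n : ℕ) (t : ℝ) (w : Ω) : ℝ :=
  ∑ k ∈ Finset.Icc (-(n : ℤ)) (n : ℤ),
    Real.sinc (ω * (t - k * Real.pi / ω)) * X (k * Real.pi / ω) w

end Processes

/-- The function `C_n(t)`, with `B₀ = B(0)`. -/
noncomputable def errorBound (B₀ ω Λ z : ℝ) (n : ℕ) (t : ℝ) : ℝ :=
  B₀ * (4 * ω * t / (Real.pi ^ 2 * (1 - z)) +
    4 * (z + 1 + 1 / (n : ℝ)) / (Real.pi * (1 - z) ^ 2 * (1 - Λ / ω))) ^ 2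

/-- `S_{n,p} = (C_X / n) ^ p ∫_0^T C_n(t) ^ (p / 2) dt`. -/
noncomputable def errorScale (C B₀ ω Λ z T p : ℝ) (n : ℕ) : ℝ :=
  (C / n) ^ p * ∫ t in (0 : ℝ)..T, errorBound B₀ ω Λ z n t ^ (p / 2)

/-! A mean-square bound for the truncation error is combined with a tail bound for `L_p`
functionals.

Mean square: by the spectral form of `B`, the second moment of a linear combination of values of `X`
is the squared `L²(F)` norm of its transfer function. For `X(t) - X_n(t)` at frequency `l`, put `x =
ωt/π` and `θ = πl/ω`: the transfer function is the remainder beyond `|k| ≤ n` of the Fourier series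
of `u ↦ exp(ixu)` at `θ`. As `|θ| ≤ πΛ/ω < π`, the series converges there
(`tendsto_sum_sinc_mul_exp`), and Abel summation makes the remainder `O(1/n)` uniformly on the
spectrum (`norm_exp_sub_sum_sinc_le`). The `SSub_φ` property then gives `E exp(a|X - X_n|/σ) ≤ 2
exp(φ(a))` with `σ = C_X √C_n / n`.

Tail: let `S = ∫ σ^p` and `x = (ε/S)^(1/p)`. If `ax ≥ p`, then `(ax/p)(u/x)^p ≤ exp(a(u - x)) + ax/p
- 1` (`mul_div_rpow_le_exp_add`). With `u = |X - X_n|/σ`, integrated against `σ^p`, this shows that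
on the event in question the `σ^p`-weighted mean of `exp(a(u - x))` is at least 1, so Markov's
inequality gives `2 exp(φ(a) - ax)`. The hypothesis on `ε` amounts to `f(p/x) < x`, so `a ↦ ax -
φ(a)` is non-decreasing on `[0, p/x]` and the restriction `a ≥ p/x` costs nothing in the supremum
`φ*(x)`. -/

/-! ### Pointwise convergence of the Fourier series of an exponential -/

/-- At `y = x - k` this identifies `sinc(π(x - k))` as the `k`-th Fourier coefficient of `u ↦
exp(ixu)`. -/
lemma integral_exp_I_eq_sinc (y : ℝ) :
    ∫ u in (-Real.pi)..Real.pi, Complex.exp (Complex.I * y * u) =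
      2 * Real.pi * (Real.sinc (Real.pi * y) : ℂ) := by
  have hpi := Real.pi_ne_zero
  by_cases hy : y = 0
  · subst hy
    simp; ring
  · have hc : Complex.I * (y : ℂ) ≠ 0 := by simp [hy]
    rw [integral_exp_mul_complex hc, Real.sinc_of_ne_zero (by positivity)]
    have h1 : Complex.exp (Complex.I * y * (Real.pi : ℝ)) -
        Complex.exp (Complex.I * y * ((-Real.pi : ℝ) : ℂ)) =
        2 * Complex.I * Complex.sin (Real.pi * y) := by
      rw [Complex.sin, show -((Real.pi : ℂ) * y) * Complex.I = Complex.I * y * ((-Real.pi : ℝ) : ℂ) by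
        push_cast; ring, show ((Real.pi : ℂ) * y) * Complex.I = Complex.I * y * ((Real.pi : ℝ) : ℂ) by
        ring]
      linear_combination (-(Complex.exp (Complex.I * y * ((-Real.pi : ℝ) : ℂ)) -
        Complex.exp (Complex.I * y * (Real.pi : ℝ)))) * Complex.I_sq
    rw [h1]
    have hy' : (y : ℂ) ≠ 0 := by exact_mod_cast hy
    have hpi' : (Real.pi : ℂ) ≠ 0 := by exact_mod_cast hpi
    push_cast
    field_simp

lemma sinc_pi_mul_int (k : ℤ) : Real.sinc (Real.pi * (0 - k)) = if k = 0 then 1 else 0 := by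
  split_ifs with h
  · simp [h]
  · rw [Real.sinc_of_ne_zero]
    · rw [zero_sub, mul_neg, Real.sin_neg, mul_comm, Real.sin_int_mul_pi]; simp
    · simp [h, Real.pi_ne_zero]

/-- Telescoping of a sum of differences over a symmetric interval of integers. -/
lemma sum_Icc_neg_sub_pred {E : Type*} [AddCommGroup E] (H : ℤ → E) (m : ℕ) :
    ∑ k ∈ Finset.Icc (-(m : ℤ)) m, (H (k - 1) - H k) = H (-(m : ℤ) - 1) - H m := by
  induction m with
  | zero => simp
  | succ m ih =>
    have : Finset.Icc (-((m + 1 : ℕ) : ℤ)) ((m + 1 : ℕ) : ℤ) =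
        insert (-((m : ℤ) + 1)) (insert ((m : ℤ) + 1) (Finset.Icc (-(m : ℤ)) m)) := by
      ext k; simp; omega
    rw [this, Finset.sum_insert (by simp; omega), Finset.sum_insert (by simp), ih]
    push_cast
    rw [show (m : ℤ) + 1 - 1 = m by ring, show -((m : ℤ) + 1) = -(m : ℤ) - 1 by ring]
    abel

/-- The Riemann-Lebesgue lemma on the line, applied to `g` cut off to `(-π, π]` and sampled at the
frequencies `k/(2π)`. -/
lemma tendsto_fourier_integral_cofinite (g : ℝ → ℂ) :
    Tendsto (fun k : ℤ => ∫ u in (-Real.pi)..Real.pi, Complex.exp (-(Complex.I * k * u)) * g u)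
      cofinite (𝓝 0) := by
  have hpi := Real.pi_pos
  have h1 := Real.tendsto_integral_exp_smul_cocompact
    ((Set.Ioc (-Real.pi) Real.pi).indicator g)
  have h2 : Tendsto (fun k : ℤ => (k : ℝ) * (2 * Real.pi)⁻¹) cofinite (cocompact ℝ) := by
    have h3 : Tendsto (fun k : ℤ => (k : ℝ)) cofinite (cocompact ℝ) :=
      Int.tendsto_coe_cofinite
    exact (Homeomorph.mulRight₀ (2 * Real.pi)⁻¹ (by positivity)).isClosedEmbedding.tendsto_cocompact.comp h3
  refine (h1.comp h2).congr fun k => ?_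
  rw [intervalIntegral.integral_of_le (by linarith), ← integral_indicator measurableSet_Ioc]
  simp only [Function.comp]
  congr 1 with u
  by_cases hu : u ∈ Set.Ioc (-Real.pi) Real.pi
  · simp only [Set.indicator_of_mem hu, Circle.smul_def, Real.fourierChar_apply, smul_eq_mul]
    congr 2
    have : (Real.pi : ℂ) ≠ 0 := by exact_mod_cast hpi.ne'
    push_cast
    field_simp
  · simp [Set.indicator_of_notMem hu]

/-- The Fourier series of `u ↦ exp (i x u)` on `(-π, π)` converges to it pointwise. -/
lemma tendsto_sum_sinc_mul_exp (x θ : ℝ) (hθ : |θ| < Real.pi) :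
    Tendsto (fun m : ℕ => ∑ k ∈ Finset.Icc (-(m : ℤ)) m,
      (Real.sinc (Real.pi * (x - k)) : ℂ) * Complex.exp (Complex.I * k * θ)) atTop
      (𝓝 (Complex.exp (Complex.I * x * θ))) := by
  have hpi := Real.pi_pos
  have hpi' : (Real.pi : ℂ) ≠ 0 := by exact_mod_cast hpi.ne'
  obtain ⟨hθ1, hθ2⟩ := abs_lt.mp hθ
  set F : ℝ → ℝ → ℂ := fun y u => Complex.exp (Complex.I * y * u)
  have hFd : ∀ y u : ℝ, HasDerivAt (F y) (Complex.exp (Complex.I * y * u) * (Complex.I * y)) u := by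
    intro y u
    have h0 : HasDerivAt (fun u : ℝ => (u : ℂ)) 1 u := Complex.ofRealCLM.hasDerivAt
    simpa using (h0.const_mul (Complex.I * y)).cexp
  have hFc : ∀ y, Continuous (dslope (F y) θ) := by
    intro y
    rw [← continuousOn_univ, continuousOn_dslope (by simp)]
    exact ⟨fun u _ => (hFd y u).continuousAt.continuousWithinAt, (hFd y θ).differentiableAt⟩
  -- Points with equal exponentials differ by a multiple of `2π`; since `θ` is interior, no other
  -- point of `[-π, π]` is that far from it.
  have hne : ∀ u ∈ Set.Icc (-Real.pi) Real.pi, dslope (F 1) θ u ≠ 0 := by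
    intro u hu h
    by_cases huθ : u = θ
    · subst huθ
      rw [dslope_same, (hFd 1 u).deriv] at h
      simp at h
    · have h1 := sub_smul_dslope (F 1) θ u
      rw [h, smul_zero] at h1
      have h2 : Complex.exp (Complex.I * (1 : ℝ) * u) = Complex.exp (Complex.I * (1 : ℝ) * θ) :=
        (sub_eq_zero.mp h1.symm)
      rw [Complex.exp_eq_exp_iff_exists_int] at h2
      obtain ⟨j, hj⟩ := h2
      have h3 : u = θ + j * (2 * Real.pi) := by
        have h4 : Complex.I * (u : ℂ) = Complex.I * ((θ + j * (2 * Real.pi) : ℝ) : ℂ) := by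
          push_cast; push_cast at hj; linear_combination hj
        exact_mod_cast mul_left_cancel₀ Complex.I_ne_zero h4
      have h5 : j ≠ 0 := by rintro rfl; simp at h3; exact huθ h3
      have h6 : j ≤ -1 ∨ 1 ≤ j := by omega
      obtain ⟨hu1, hu2⟩ := hu
      rcases h6 with h6 | h6
      · have : (j : ℝ) ≤ -1 := by exact_mod_cast h6
        nlinarith
      · have : (1 : ℝ) ≤ j := by exact_mod_cast h6
        nlinarith
  -- Chernoff's device: dividing `exp(ixu) - exp(ixθ)` by `exp(iu) - exp(iθ)` leaves a continuous
  -- `g`, so the Fourier sum of the difference telescopes at `θ`.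
  set g : ℝ → ℂ := fun u => dslope (F x) θ u / dslope (F 1) θ u
  have hgc : ContinuousOn g (Set.Icc (-Real.pi) Real.pi) :=
    (hFc x).continuousOn.div (hFc 1).continuousOn hne
  have hgF : ∀ u ∈ Set.Icc (-Real.pi) Real.pi, F x u - F x θ = g u * (F 1 u - F 1 θ) := by
    intro u hu
    rw [← sub_smul_dslope, ← sub_smul_dslope, mul_smul_comm, div_mul_cancel₀ _ (hne u hu)]
  set G : ℤ → ℂ := fun k => ∫ u in (-Real.pi)..Real.pi, Complex.exp (-(Complex.I * k * u)) * g u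
  have hle : -Real.pi ≤ Real.pi := by linarith
  have hint : ∀ k : ℤ, IntervalIntegrable (fun u : ℝ => Complex.exp (-(Complex.I * k * u)) * g u)
      volume (-Real.pi) Real.pi := by
    intro k
    apply ContinuousOn.intervalIntegrable
    rw [Set.uIcc_of_le hle]
    exact ContinuousOn.mul (by fun_prop) hgc
  set H : ℤ → ℂ := fun k => Complex.exp (Complex.I * (k + 1) * θ) * G k
  have hkey : ∀ k : ℤ, 2 * Real.pi * ((Real.sinc (Real.pi * (x - k)) : ℂ) -
      Complex.exp (Complex.I * x * θ) * (Real.sinc (Real.pi * (0 - k)) : ℂ)) *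
        Complex.exp (Complex.I * k * θ) = H (k - 1) - H k := by
    intro k
    have e1 := integral_exp_I_eq_sinc (x - k)
    have e2 := integral_exp_I_eq_sinc (0 - k)
    -- Multiplication by `exp(iu)` lowers the index of a Fourier coefficient by one.
    have e3 : G (k - 1) - F 1 θ * G k = 2 * Real.pi * ((Real.sinc (Real.pi * (x - k)) : ℂ) -
      Complex.exp (Complex.I * x * θ) * (Real.sinc (Real.pi * (0 - k)) : ℂ)) := by
      rw [mul_sub, ← e1, mul_left_comm, ← e2]
      simp only [G]
      rw [← intervalIntegral.integral_const_mul, ← intervalIntegral.integral_const_mul,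
        ← intervalIntegral.integral_sub (hint _) ((hint _).const_mul _),
        ← intervalIntegral.integral_sub]
      · apply intervalIntegral.integral_congr
        intro u hu
        rw [Set.uIcc_of_le hle] at hu
        have h1 := hgF u hu
        simp only
        have e4 : Complex.exp (-(Complex.I * ((k - 1 : ℤ) : ℂ) * u)) =
            Complex.exp (-(Complex.I * k * u)) * F 1 u := by
          simp only [F]; rw [← Complex.exp_add]; congr 1; push_cast; ring
        have e5 : Complex.exp (Complex.I * ((x - k : ℝ) : ℂ) * u) =
            Complex.exp (-(Complex.I * k * u)) * F x u := by
          simp only [F]; rw [← Complex.exp_add]; congr 1; push_cast; ring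
        have e6 : Complex.exp (Complex.I * ((0 - k : ℝ) : ℂ) * u) =
            Complex.exp (-(Complex.I * k * u)) := by
          congr 1; push_cast; ring
        rw [e4, e5, e6]
        change _ = Complex.exp (-(Complex.I * k * u)) * F x u - F x θ * _
        linear_combination -(Complex.exp (-(Complex.I * k * u))) * h1
      · exact Continuous.intervalIntegrable (by fun_prop) _ _
      · exact Continuous.intervalIntegrable (by fun_prop) _ _
    rw [← e3]
    simp only [H, F]
    have e7 : Complex.exp (Complex.I * ((k : ℂ) + 1) * θ) =
        Complex.exp (Complex.I * (1 : ℝ) * θ) * Complex.exp (Complex.I * k * θ) := by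
      rw [← Complex.exp_add]; congr 1; push_cast; ring
    have e8 : Complex.I * (((k - 1 : ℤ) : ℂ) + 1) * θ = Complex.I * k * θ := by push_cast; ring
    rw [e7, e8]
    ring
  have hH : Tendsto H cofinite (𝓝 0) := by
    rw [tendsto_zero_iff_norm_tendsto_zero]
    refine (tendsto_zero_iff_norm_tendsto_zero.mp (tendsto_fourier_integral_cofinite g)).congr ?_
    intro k
    simp only [H, G, norm_mul]
    rw [show Complex.I * ((k : ℂ) + 1) * θ = (((k + 1) * θ : ℝ) : ℂ) * Complex.I by push_cast; ring,
      Complex.norm_exp_ofReal_mul_I, one_mul]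
  have hsum : ∀ m : ℕ, 2 * Real.pi * ((∑ k ∈ Finset.Icc (-(m : ℤ)) m,
      (Real.sinc (Real.pi * (x - k)) : ℂ) * Complex.exp (Complex.I * k * θ)) -
        Complex.exp (Complex.I * x * θ)) = H (-(m : ℤ) - 1) - H m := by
    intro m
    rw [← sum_Icc_neg_sub_pred, ← Finset.sum_congr rfl (fun k _ => hkey k)]
    -- The Fourier series of the constant 1 has only its term at `k = 0`.
    have h1 : ∑ k ∈ Finset.Icc (-(m : ℤ)) m, (Real.sinc (Real.pi * (0 - k)) : ℂ) *
        Complex.exp (Complex.I * k * θ) = 1 := by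
      simp_rw [sinc_pi_mul_int]
      rw [Finset.sum_eq_single 0]
      · simp
      · intro b _ hb; simp [hb]
      · simp
    simp_rw [mul_assoc, ← Finset.mul_sum]
    simp_rw [mul_assoc] at h1
    simp_rw [sub_mul, Finset.sum_sub_distrib, mul_assoc, ← Finset.mul_sum]
    rw [h1, mul_one]
  have hlim : Tendsto (fun m : ℕ => (2 * Real.pi : ℂ)⁻¹ * (H (-(m : ℤ) - 1) - H m) +
      Complex.exp (Complex.I * x * θ)) atTop (𝓝 (Complex.exp (Complex.I * x * θ))) := by
    have h1 : Tendsto (fun m : ℕ => H m) atTop (𝓝 0) := by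
      rw [← Nat.cofinite_eq_atTop]
      exact hH.comp (Nat.cast_injective.tendsto_cofinite)
    have h2 : Tendsto (fun m : ℕ => H (-(m : ℤ) - 1)) atTop (𝓝 0) := by
      rw [← Nat.cofinite_eq_atTop]
      refine hH.comp (Function.Injective.tendsto_cofinite (f := fun m : ℕ => -(m : ℤ) - 1) ?_)
      intro a b hab
      simp at hab
      exact hab
    simpa using ((h2.sub h1).const_mul ((2 * Real.pi : ℂ)⁻¹)).add_const
      (Complex.exp (Complex.I * x * θ))
  refine hlim.congr fun m => ?_
  rw [← hsum, inv_mul_cancel_left₀ (by simp), sub_add_cancel]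

/-! ### Truncation error of the Fourier series -/

/-- Abel's estimate for a sum of unimodular powers with non-negative decreasing weights. -/
lemma norm_sum_antitone_mul_pow_le (a : ℕ → ℝ) (ha : Antitone a) (ha0 : ∀ k, 0 ≤ a k) (r : ℂ)
    (hr : ‖r‖ = 1) (N : ℕ) :
    ‖(1 - r) * ∑ k ∈ Finset.range N, (a k : ℂ) * r ^ k‖ ≤ 2 * a 0 := by
  -- The added boundary term leaves exactly `a 0 + ∑ (a k - a (k - 1)) r^k`, whose norm telescopes.
  have key : ∀ N : ℕ, ‖(1 - r) * ∑ k ∈ Finset.range (N + 1), (a k : ℂ) * r ^ k +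
      a N * r ^ (N + 1)‖ ≤ 2 * a 0 - a N := by
    intro N
    induction N with
    | zero =>
      have h1 : (1 - r) * ∑ k ∈ Finset.range (0 + 1), (a k : ℂ) * r ^ k + a 0 * r ^ (0 + 1) =
        a 0 := by simp; ring
      rw [h1, Complex.norm_real, Real.norm_of_nonneg (ha0 0)]
      linarith
    | succ N ih =>
      rw [Finset.sum_range_succ, show (1 - r) * (∑ k ∈ Finset.range (N + 1), (a k : ℂ) * r ^ k +
        a (N + 1) * r ^ (N + 1)) + a (N + 1) * r ^ (N + 1 + 1) =
        ((1 - r) * ∑ k ∈ Finset.range (N + 1), (a k : ℂ) * r ^ k + a N * r ^ (N + 1)) +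
        ((a (N + 1) - a N : ℝ) : ℂ) * r ^ (N + 1) by push_cast; ring]
      refine (norm_add_le _ _).trans ?_
      rw [norm_mul, norm_pow, hr, Complex.norm_real, Real.norm_eq_abs,
        abs_of_nonpos (by linarith [ha (Nat.le_succ N)])]
      simp only [one_pow]
      linarith
  cases N with
  | zero => simpa using ha0 0
  | succ N =>
    have h1 := key N
    have h2 : ‖(a N : ℂ) * r ^ (N + 1)‖ = a N := by
      rw [norm_mul, norm_pow, hr, Complex.norm_real, Real.norm_of_nonneg (ha0 N)]; simp
    have h3 := norm_sub_le ((1 - r) * ∑ k ∈ Finset.range (N + 1), (a k : ℂ) * r ^ k +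
      a N * r ^ (N + 1)) ((a N : ℂ) * r ^ (N + 1))
    rw [add_sub_cancel_right, h2] at h3
    linarith

/-- The norm is `2 cos(θ/2)`, and the cosine lies above its chord on `[0, π/2]`. -/
lemma two_mul_one_sub_le_norm_one_add_exp (θ : ℝ) (hθ : |θ| ≤ Real.pi) :
    2 * (1 - |θ| / Real.pi) ≤ ‖1 + Complex.exp (Complex.I * θ)‖ := by
  have h1 : 1 + Complex.exp (Complex.I * θ) =
      ((2 * Real.cos (θ / 2) : ℝ) : ℂ) * Complex.exp (((θ / 2 : ℝ) : ℂ) * Complex.I) := by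
    push_cast
    rw [Complex.cos, mul_div_cancel₀ _ (two_ne_zero), add_mul, ← Complex.exp_add,
      ← Complex.exp_add, add_comm]
    congr 1
    · congr 1; ring
    · rw [← Complex.exp_zero]; congr 1; ring
  rw [h1, norm_mul, Complex.norm_exp_ofReal_mul_I, mul_one, Complex.norm_real, Real.norm_eq_abs]
  refine le_trans ?_ (le_abs_self _)
  have h2 := Real.one_sub_mul_le_cos (x := |θ| / 2) (by positivity) (by linarith)
  have h3 : Real.cos (|θ| / 2) = Real.cos (θ / 2) := by
    rw [← Real.cos_abs (θ / 2), abs_div, abs_two]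
  rw [h3] at h2
  have h4 : 2 / Real.pi * (|θ| / 2) = |θ| / Real.pi := by ring
  linarith

/-- For `k > y` the coefficient is, up to the fixed factor `-sin(πy)/π`, the alternating sign
`(-1)^k` times the decreasing weight `1/(k - y)`. Absorbing the sign into `r = -exp(iθ)` brings
Abel's estimate to bear, with `‖1 - r‖` bounded below away from `θ = ±π`. -/
lemma norm_sum_sinc_tail_le (n N : ℕ) (y θ : ℝ) (hy : y < n + 1) (hθ : |θ| < Real.pi) :
    ‖∑ j ∈ Finset.range N, (Real.sinc (Real.pi * (y - (n + 1 + j : ℕ))) : ℂ) *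
      Complex.exp (Complex.I * (n + 1 + j : ℕ) * θ)‖ ≤
      1 / (Real.pi * (n + 1 - y) * (1 - |θ| / Real.pi)) := by
  have hpi := Real.pi_pos
  have hpi' : (Real.pi : ℂ) ≠ 0 := by exact_mod_cast hpi.ne'
  set r : ℂ := -Complex.exp (Complex.I * θ)
  have hr : ‖r‖ = 1 := by
    rw [norm_neg, mul_comm, Complex.norm_exp_ofReal_mul_I]
  set a : ℕ → ℝ := fun j => 1 / (n + 1 + j - y)
  have hpos : ∀ j : ℕ, 0 < (n : ℝ) + 1 + j - y := fun j => by
    have : (0 : ℝ) ≤ j := Nat.cast_nonneg j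
    linarith
  have ha : Antitone a := by
    intro i j hij
    have : (i : ℝ) ≤ j := by exact_mod_cast hij
    exact one_div_le_one_div_of_le (hpos i) (by linarith)
  have ha0 : ∀ j, 0 ≤ a j := fun j => (one_div_pos.mpr (hpos j)).le
  have hterm : ∀ j : ℕ, (Real.sinc (Real.pi * (y - (n + 1 + j : ℕ))) : ℂ) *
      Complex.exp (Complex.I * (n + 1 + j : ℕ) * θ) =
      (-(Real.sin (Real.pi * y) / Real.pi : ℝ) * r ^ (n + 1)) * ((a j : ℂ) * r ^ j) := by
    intro j
    have hj := hpos j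
    have hj' : ((n : ℂ) + 1 + j - y) ≠ 0 := by
      exact_mod_cast hj.ne'
    have h1 : Real.sin (Real.pi * (y - (n + 1 + j : ℕ))) =
        (-1) ^ (n + 1 + j) * Real.sin (Real.pi * y) := by
      rw [mul_sub, mul_comm Real.pi ((n + 1 + j : ℕ) : ℝ), Real.sin_sub_nat_mul_pi]
    have h0 : Real.pi * (y - (n + 1 + j : ℕ)) ≠ 0 := by
      refine mul_ne_zero hpi.ne' ?_
      push_cast; linarith
    have h2 : Real.sinc (Real.pi * (y - (n + 1 + j : ℕ))) =
        -(Real.sin (Real.pi * y) / Real.pi) * (-1) ^ (n + 1 + j) * a j := by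
      rw [Real.sinc_of_ne_zero h0, h1]
      simp only [a]
      rw [show Real.pi * (y - (n + 1 + j : ℕ)) = -(Real.pi * (n + 1 + j - y)) by push_cast; ring]
      field_simp
    have h3 : Complex.exp (Complex.I * (n + 1 + j : ℕ) * θ) =
        (-1) ^ (n + 1 + j) * r ^ (n + 1 + j) := by
      rw [← mul_pow]
      simp only [r]
      rw [neg_one_mul, neg_neg, ← Complex.exp_nat_mul]
      congr 1; ring
    have h4 : ((-1 : ℂ) ^ (n + 1 + j)) * (-1) ^ (n + 1 + j) = 1 := by
      rw [← mul_pow]; simp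
    rw [h2, h3, pow_add r (n + 1) j]
    push_cast
    linear_combination (-(Complex.sin (Real.pi * y) / Real.pi) * a j * r ^ (n + 1) * r ^ j) * h4
  rw [Finset.sum_congr rfl (fun j _ => hterm j), ← Finset.mul_sum, norm_mul, norm_mul, norm_pow,
    hr, one_pow, mul_one, norm_neg, Complex.norm_real, Real.norm_eq_abs, abs_div, abs_of_pos hpi]
  have hA := norm_sum_antitone_mul_pow_le a ha ha0 r hr N
  rw [norm_mul] at hA
  have hB := two_mul_one_sub_le_norm_one_add_exp θ hθ.le
  have hr1 : 1 - r = 1 + Complex.exp (Complex.I * θ) := by simp [r]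
  rw [← hr1] at hB
  have hd : 0 < 1 - |θ| / Real.pi := by
    rw [sub_pos, div_lt_one hpi]; exact hθ
  set V := ‖∑ j ∈ Finset.range N, (a j : ℂ) * r ^ j‖
  have hS : 0 ≤ V := norm_nonneg _
  have hC : (1 - |θ| / Real.pi) * V ≤ a 0 := by nlinarith
  have hC' : V ≤ a 0 / (1 - |θ| / Real.pi) := by
    rw [le_div_iff₀ hd]; linarith
  have hs : |Real.sin (Real.pi * y)| ≤ 1 := Real.abs_sin_le_one _
  calc |Real.sin (Real.pi * y)| / Real.pi * V ≤ 1 / Real.pi * (a 0 / (1 - |θ| / Real.pi)) := by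
        gcongr
    _ = _ := by
        simp only [a, Nat.cast_zero, add_zero]
        rw [mul_assoc, ← one_div_mul_one_div, ← one_div_mul_one_div]
        ring

lemma sum_Icc_neg_add {E : Type*} [AddCommMonoid E] (g : ℤ → E) (n N : ℕ) :
    ∑ k ∈ Finset.Icc (-((n + N : ℕ) : ℤ)) ((n + N : ℕ) : ℤ), g k =
      ∑ k ∈ Finset.Icc (-(n : ℤ)) n, g k +
        (∑ j ∈ Finset.range N, g (n + 1 + j : ℕ) + ∑ j ∈ Finset.range N, g (-(n + 1 + j : ℕ))) := by
  induction N with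
  | zero => simp
  | succ N ih =>
    have : Finset.Icc (-((n + (N + 1) : ℕ) : ℤ)) ((n + (N + 1) : ℕ) : ℤ) =
        insert (-((n + 1 + N : ℕ) : ℤ)) (insert ((n + 1 + N : ℕ) : ℤ)
          (Finset.Icc (-((n + N : ℕ) : ℤ)) (n + N : ℕ))) := by
      ext k; simp; omega
    rw [this, Finset.sum_insert (by simp; omega), Finset.sum_insert (by simp), ih,
      Finset.sum_range_succ, Finset.sum_range_succ]
    abel

/-- The truncation error of the Fourier series of `u ↦ exp (i x u)` on `(-π, π)`. -/
lemma norm_exp_sub_sum_sinc_le (n : ℕ) (x θ : ℝ) (hx : |x| < n + 1) (hθ : |θ| < Real.pi) :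
    ‖Complex.exp (Complex.I * x * θ) - ∑ k ∈ Finset.Icc (-(n : ℤ)) n,
      (Real.sinc (Real.pi * (x - k)) : ℂ) * Complex.exp (Complex.I * k * θ)‖ ≤
      1 / (Real.pi * (1 - |θ| / Real.pi)) * (1 / (n + 1 - x) + 1 / (n + 1 + x)) := by
  obtain ⟨hx1, hx2⟩ := abs_lt.mp hx
  have h1 := (tendsto_sum_sinc_mul_exp x θ hθ).comp (tendsto_add_atTop_nat n)
  have h2 := (h1.sub_const (∑ k ∈ Finset.Icc (-(n : ℤ)) n,
      (Real.sinc (Real.pi * (x - k)) : ℂ) * Complex.exp (Complex.I * k * θ))).norm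
  refine le_of_tendsto h2 (Eventually.of_forall fun N => ?_)
  simp only [Function.comp]
  rw [add_comm N n, sum_Icc_neg_add, add_sub_cancel_left]
  refine (norm_add_le _ _).trans ?_
  have h3 := norm_sum_sinc_tail_le n N x θ hx2 hθ
  -- As `sinc` is even, the negative indices form the same tail with `x` and `θ` negated.
  have h4 := norm_sum_sinc_tail_le n N (-x) (-θ) (by linarith) (by rwa [abs_neg])
  have h5 : ∀ j : ℕ, (Real.sinc (Real.pi * (x - ((-((n + 1 + j : ℕ) : ℤ) : ℤ) : ℝ))) : ℂ) *
      Complex.exp (Complex.I * ((-((n + 1 + j : ℕ) : ℤ) : ℤ) : ℂ) * θ) =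
      (Real.sinc (Real.pi * (-x - (n + 1 + j : ℕ))) : ℂ) *
      Complex.exp (Complex.I * (n + 1 + j : ℕ) * (-θ : ℝ)) := by
    intro j
    congr 2
    · rw [← Real.sinc_neg]; congr 1; push_cast; ring
    · push_cast; ring
  rw [← Finset.sum_congr rfl (fun j _ => h5 j)] at h4
  refine (add_le_add h3 h4).trans_eq ?_
  rw [abs_neg, sub_neg_eq_add, mul_add (1 / _), one_div_mul_one_div, one_div_mul_one_div]
  congr 2 <;> ring

/-! ### N-functions and exponential moments in `Sub_φ` -/

namespace IsOrliczNFunction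

variable {φ : ℝ → ℝ}

lemma nonneg (h : IsOrliczNFunction φ) (x : ℝ) : 0 ≤ φ x := by
  have h1 := h.convex.2 (Set.mem_univ x) (Set.mem_univ (-x))
    (show (0 : ℝ) ≤ 1 / 2 by norm_num) (show (0 : ℝ) ≤ 1 / 2 by norm_num) (by norm_num)
  simp only [smul_eq_mul, h.even] at h1
  rw [show (1 / 2 : ℝ) * x + 1 / 2 * -x = 0 by ring, h.map_zero] at h1
  linarith

lemma strictMonoOn_Ici (h : IsOrliczNFunction φ) : StrictMonoOn φ (Set.Ici 0) := by
  intro x hx y hy hxy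
  have hx' : 0 ≤ x := hx
  rcases hx'.eq_or_lt with rfl | hx0
  · rw [h.map_zero]
    exact (h.nonneg (y / 2)).trans_lt (h.strictMonoOn (half_pos hxy) hxy (half_lt_self hxy))
  · exact h.strictMonoOn hx0 (hx0.trans hxy) hxy

lemma apply_abs (h : IsOrliczNFunction φ) (x : ℝ) : φ |x| = φ x := by
  rcases abs_choice x with hx | hx
  · rw [hx]
  · rw [hx, h.even]

lemma apply_le_apply (h : IsOrliczNFunction φ) {x y : ℝ} (hxy : |x| ≤ |y|) : φ x ≤ φ y := by
  rw [← h.apply_abs x, ← h.apply_abs y]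
  exact h.strictMonoOn_Ici.monotoneOn (abs_nonneg x) (abs_nonneg y) hxy

lemma tendsto_atTop (h : IsOrliczNFunction φ) : Tendsto φ atTop atTop := by
  refine (h.tendsto_div_atTop.atTop_mul_atTop₀ tendsto_id).congr' ?_
  filter_upwards [eventually_gt_atTop 0] with x hx
  simp only [id]
  field_simp

/-- This makes `Function.invFunOn` in `subNorm` a genuine inverse at non-negative arguments. -/
lemma exists_nonneg_eq (h : IsOrliczNFunction φ) {v : ℝ} (hv : 0 ≤ v) :
    ∃ u ∈ Set.Ici (0 : ℝ), φ u = v := by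
  obtain ⟨b, hb, hb0⟩ := ((h.tendsto_atTop.eventually_ge_atTop v).and
    (eventually_ge_atTop 0)).exists
  have h1 := intermediate_value_Icc hb0 h.continuous.continuousOn
  rw [h.map_zero] at h1
  obtain ⟨u, hu, huv⟩ := h1 ⟨hv, hb⟩
  exact ⟨u, hu.1, huv⟩

end IsOrliczNFunction

section SubGaussianType

variable {Ω : Type*} [MeasurableSpace Ω] {P : Measure Ω} [IsProbabilityMeasure P]
  {φ : ℝ → ℝ}

/-- Zero mean and `1 + v ≤ exp v`; hence the logarithm in `subNorm` stays in the range of `φ`. -/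
lemma IsSub.one_le_integral_exp {ξ : Ω → ℝ} (hξ : IsSub φ P ξ) (l : ℝ) :
    1 ≤ ∫ w, Real.exp (l * ξ w) ∂P := by
  obtain ⟨hi, h0, a, ha, h⟩ := hξ
  have h1 : ∫ w, (l * ξ w + 1) ∂P = 1 := by
    rw [integral_add (hi.const_mul l) (integrable_const _), integral_const_mul, h0]
    simp
  rw [← h1]
  exact integral_mono ((hi.const_mul l).add (integrable_const _)) (h l).1
    fun w => Real.add_one_le_exp _

/-- The norm `τ_φ` controls the exponential moments. -/
lemma IsSub.integral_exp_le {ξ : Ω → ℝ} (hφ : IsOrliczNFunction φ) (hξ : IsSub φ P ξ) {s : ℝ}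
    (hs : subNorm φ P ξ ≤ s) (l : ℝ) :
    ∫ w, Real.exp (l * ξ w) ∂P ≤ Real.exp (φ (s * l)) := by
  obtain ⟨hi, h0, a, ha, h⟩ := id hξ
  by_cases hl : l = 0
  · subst hl
    simp [hφ.map_zero]
  set inv := fun l : ℝ =>
    Function.invFunOn φ (Set.Ici 0) (Real.log (∫ w, Real.exp (l * ξ w) ∂P))
  have hlog : ∀ l : ℝ, 0 ≤ Real.log (∫ w, Real.exp (l * ξ w) ∂P) := fun l =>
    Real.log_nonneg (hξ.one_le_integral_exp l)
  have hmem : ∀ l : ℝ, 0 ≤ inv l := fun l =>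
    Function.invFunOn_mem (hφ.exists_nonneg_eq (hlog l))
  have heq : ∀ l : ℝ, φ (inv l) = Real.log (∫ w, Real.exp (l * ξ w) ∂P) := fun l =>
    Function.invFunOn_eq (hφ.exists_nonneg_eq (hlog l))
  have hpos : ∀ l : ℝ, 0 < ∫ w, Real.exp (l * ξ w) ∂P := fun l =>
    zero_lt_one.trans_le (hξ.one_le_integral_exp l)
  -- Without this bound the real supremum would default to 0 and control no individual `l`.
  have hbdd : BddAbove (Set.range fun l : {l : ℝ // l ≠ 0} => inv l.1 / |l.1|) := by
    refine ⟨a, ?_⟩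
    rintro _ ⟨⟨l, hl⟩, rfl⟩
    simp only
    rw [div_le_iff₀ (abs_pos.mpr hl)]
    have h1 : φ (inv l) ≤ φ (a * |l|) := by
      rw [heq, Real.log_le_iff_le_exp (hpos l)]
      refine (h l).2.trans (Real.exp_le_exp.mpr (hφ.apply_le_apply ?_))
      rw [abs_mul, abs_mul, abs_abs]
    exact (hφ.strictMonoOn_Ici.le_iff_le (hmem l) (mul_nonneg ha (abs_nonneg l))).mp h1
  have h1 : inv l / |l| ≤ s := (le_ciSup hbdd ⟨l, hl⟩).trans hs
  rw [div_le_iff₀ (abs_pos.mpr hl)] at h1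
  rw [← Real.log_le_iff_le_exp (hpos l), ← heq]
  apply hφ.apply_le_apply
  rw [abs_of_nonneg (hmem l), abs_mul]
  exact h1.trans (mul_le_mul_of_nonneg_right (le_abs_self s) (abs_nonneg l))

/-- `Sub_φ(Ω)` is closed under finite linear combinations. -/
lemma IsSub.sum {ι : Type*} {X : ι → Ω → ℝ} (hφ : IsOrliczNFunction φ)
    (hX : ∀ i, IsSub φ P (X i)) (I : Finset ι) (c : ι → ℝ) :
    IsSub φ P (fun w => ∑ i ∈ I, c i * X i w) := by
  have hint : Integrable (fun w => ∑ i ∈ I, c i * X i w) P :=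
    integrable_finsetSum _ fun i _ => (hX i).1.const_mul _
  refine ⟨hint, ?_, ?_⟩
  · rw [integral_finsetSum _ fun i _ => (hX i).1.const_mul _]
    refine Finset.sum_eq_zero fun i _ => ?_
    rw [integral_const_mul, (hX i).2.1, mul_zero]
  choose a ha h using fun i => (hX i).2.2
  rcases I.eq_empty_or_nonempty with rfl | hI
  · exact ⟨0, le_rfl, fun l => by simp [hφ.map_zero]⟩
  set m : ℝ := (I.card : ℝ)
  have hm : 0 < m := by
    simp only [m]; exact_mod_cast hI.card_pos
  -- Jensen's inequality with equal weights `1/m`, which needs no independence.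
  have hconv : ∀ (l : ℝ) (w : Ω), Real.exp (l * ∑ i ∈ I, c i * X i w) ≤
      ∑ i ∈ I, m⁻¹ * Real.exp ((l * m * c i) * X i w) := by
    intro l w
    have h1 := convexOn_exp.map_sum_le (t := I) (w := fun _ => m⁻¹)
      (p := fun i => (l * m * c i) * X i w) (fun _ _ => by positivity)
      (by rw [Finset.sum_const, nsmul_eq_mul]; exact mul_inv_cancel₀ hm.ne')
      (fun _ _ => Set.mem_univ _)
    simp only [smul_eq_mul] at h1
    refine le_of_eq_of_le (congrArg Real.exp ?_) h1
    rw [Finset.mul_sum]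
    refine Finset.sum_congr rfl fun i _ => ?_
    field_simp
  have hdom : ∀ l : ℝ, Integrable (fun w => ∑ i ∈ I, m⁻¹ * Real.exp ((l * m * c i) * X i w)) P :=
    fun l => integrable_finsetSum _ fun i _ => (h i _).1.const_mul _
  have hexp : ∀ l : ℝ, Integrable (fun w => Real.exp (l * ∑ i ∈ I, c i * X i w)) P := fun l =>
    (hdom l).mono' (Real.continuous_exp.comp_aestronglyMeasurable
      (hint.aestronglyMeasurable.const_mul l))
      (Eventually.of_forall fun w => by
        rw [Real.norm_of_nonneg (Real.exp_pos _).le]; exact hconv l w)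
  refine ⟨∑ i ∈ I, |m * c i * a i|, Finset.sum_nonneg fun _ _ => abs_nonneg _,
    fun l => ⟨hexp l, ?_⟩⟩
  refine (integral_mono (hexp l) (hdom l) (hconv l)).trans ?_
  rw [integral_finsetSum _ fun i _ => (h i _).1.const_mul _]
  have h2 : ∀ i ∈ I, ∫ w, m⁻¹ * Real.exp ((l * m * c i) * X i w) ∂P ≤
      m⁻¹ * Real.exp (φ ((∑ i ∈ I, |m * c i * a i|) * l)) := by
    intro i hi
    rw [integral_const_mul]
    refine mul_le_mul_of_nonneg_left ((h i _).2.trans (Real.exp_le_exp.mpr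
      (hφ.apply_le_apply ?_))) (by positivity)
    have h3 : 0 ≤ ∑ i ∈ I, |m * c i * a i| := Finset.sum_nonneg fun _ _ => abs_nonneg _
    rw [abs_mul (∑ i ∈ I, |m * c i * a i|) l, abs_of_nonneg h3,
      show a i * (l * m * c i) = (m * c i * a i) * l by ring, abs_mul _ l]
    exact mul_le_mul_of_nonneg_right
      (Finset.single_le_sum (f := fun i => |m * c i * a i|) (fun _ _ => abs_nonneg _) hi)
      (abs_nonneg l)
  refine (Finset.sum_le_sum h2).trans_eq ?_
  rw [Finset.sum_const, nsmul_eq_mul, mul_inv_cancel_left₀ hm.ne']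

lemma IsSSubWith.integral_exp_le {ι : Type*} {X : ι → Ω → ℝ} {C : ℝ} (hφ : IsOrliczNFunction φ)
    (hX : IsSSubWith φ P X C) (I : Finset ι) (c : ι → ℝ) {s : ℝ}
    (hs : C * Real.sqrt (∫ w, (∑ i ∈ I, c i * X i w) ^ 2 ∂P) ≤ s) (l : ℝ) :
    Integrable (fun w => Real.exp (l * ∑ i ∈ I, c i * X i w)) P ∧
      ∫ w, Real.exp (l * ∑ i ∈ I, c i * X i w) ∂P ≤ Real.exp (φ (s * l)) := by
  have h1 := IsSub.sum hφ hX.1 I c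
  obtain ⟨a, -, h⟩ := h1.2.2
  exact ⟨(h l).1, h1.integral_exp_le hφ ((hX.2.2 I c).trans hs) l⟩

/-- The two-sided exponential moment of a linear combination of values of an `SSub_φ` process. -/
lemma IsSSubWith.lintegral_exp_abs_le {ι : Type*} {X : ι → Ω → ℝ} {C : ℝ}
    (hφ : IsOrliczNFunction φ) (hX : IsSSubWith φ P X C) (I : Finset ι) (c : ι → ℝ) {s : ℝ}
    (hs0 : 0 < s) (hs : C * Real.sqrt (∫ w, (∑ i ∈ I, c i * X i w) ^ 2 ∂P) ≤ s) (a : ℝ) :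
    ∫⁻ w, ENNReal.ofReal (Real.exp (a * (|∑ i ∈ I, c i * X i w| / s))) ∂P ≤
      ENNReal.ofReal (2 * Real.exp (φ a)) := by
  obtain ⟨i1, h1⟩ := hX.integral_exp_le hφ I c hs (a / s)
  obtain ⟨i2, h2⟩ := hX.integral_exp_le hφ I c hs (-(a / s))
  rw [mul_neg, hφ.even] at h2
  rw [mul_div_cancel₀ _ hs0.ne'] at h1 h2
  set ξ : Ω → ℝ := fun w => ∑ i ∈ I, c i * X i w
  calc ∫⁻ w, ENNReal.ofReal (Real.exp (a * (|ξ w| / s))) ∂P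
      ≤ ∫⁻ w, ENNReal.ofReal (Real.exp (a / s * ξ w) + Real.exp (-(a / s) * ξ w)) ∂P := by
        refine lintegral_mono fun w => ENNReal.ofReal_le_ofReal ?_
        rcases abs_choice (ξ w) with h | h
        · rw [h, show a * (ξ w / s) = a / s * ξ w by ring]
          linarith [Real.exp_pos (-(a / s) * ξ w)]
        · rw [h, show a * (-ξ w / s) = -(a / s) * ξ w by ring]
          linarith [Real.exp_pos (a / s * ξ w)]
    _ = ENNReal.ofReal (∫ w, (Real.exp (a / s * ξ w) + Real.exp (-(a / s) * ξ w)) ∂P) := by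
        exact (ofReal_integral_eq_lintegral_ofReal (i1.add i2)
          (Eventually.of_forall fun w => by simp only [Pi.add_apply]; positivity)).symm
    _ ≤ _ := by
        refine ENNReal.ofReal_le_ofReal ?_
        rw [integral_add i1 i2]
        linarith

end SubGaussianType

/-! ### Second moments and the mean-square truncation error -/

section Stationary

variable {Ω : Type*} [MeasurableSpace Ω] {P : Measure Ω} {X : ℝ → Ω → ℝ}

lemma IsCentredStationary.integral_sum_sq (hX : IsCentredStationary P X) (I : Finset ℝ)
    (c : ℝ → ℝ) : ∫ w, (∑ s ∈ I, c s * X s w) ^ 2 ∂P =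
      ∑ s ∈ I, ∑ r ∈ I, c s * c r * covFun P X (s - r) := by
  have hint : ∀ s r, Integrable (fun w => X s w * X r w) P := fun s r =>
    (hX.1 s).integrable_mul (hX.1 r)
  have h1 : ∀ w, (∑ s ∈ I, c s * X s w) ^ 2 =
      ∑ s ∈ I, ∑ r ∈ I, c s * c r * (X s w * X r w) := by
    intro w
    rw [sq, Finset.sum_mul_sum]
    refine Finset.sum_congr rfl fun s _ => Finset.sum_congr rfl fun r _ => ?_
    ring
  simp_rw [h1]
  rw [integral_finsetSum _ fun s _ => integrable_finsetSum _ fun r _ => (hint s r).const_mul _]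
  refine Finset.sum_congr rfl fun s _ => ?_
  rw [integral_finsetSum _ fun r _ => (hint s r).const_mul _]
  refine Finset.sum_congr rfl fun r _ => ?_
  rw [integral_const_mul, ← hX.2.2 r (s - r), add_sub_cancel]

/-- If the transfer function of a linear combination is bounded by `K` on the spectrum, its second
moment is at most `K ^ 2 * B 0`. -/
lemma IsCentredStationary.integral_sum_sq_le (hX : IsCentredStationary P X) {F : Measure ℝ}
    [IsFiniteMeasure F]
    (hF : ∀ τ : ℝ, (covFun P X τ : ℂ) = ∫ l : ℝ, Complex.exp (Complex.I * τ * l) ∂F)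
    (I : Finset ℝ) (c : ℝ → ℝ) {K : ℝ}
    (hK : ∀ᵐ l : ℝ ∂F, ‖∑ s ∈ I, (c s : ℂ) * Complex.exp (Complex.I * s * l)‖ ≤ K) :
    ∫ w, (∑ s ∈ I, c s * X s w) ^ 2 ∂P ≤ K ^ 2 * covFun P X 0 := by
  have hcov0 : covFun P X 0 = F.real Set.univ := by
    have h := hF 0
    simp at h
    exact_mod_cast h
  have hexp : ∀ τ : ℝ, Integrable (fun l : ℝ => Complex.exp (Complex.I * τ * l)) F := by
    intro τ
    refine Integrable.of_bound (C := 1) (Continuous.aestronglyMeasurable (by fun_prop))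
      (Eventually.of_forall fun l => ?_)
    rw [show Complex.I * (τ : ℂ) * l = ((τ * l : ℝ) : ℂ) * Complex.I by push_cast; ring,
      Complex.norm_exp_ofReal_mul_I]
  have hnorm : ∀ l : ℝ, ((‖∑ s ∈ I, (c s : ℂ) * Complex.exp (Complex.I * s * l)‖ ^ 2 : ℝ) : ℂ) =
      ∑ s ∈ I, ∑ r ∈ I, (c s * c r : ℂ) * Complex.exp (Complex.I * (s - r : ℝ) * l) := by
    intro l
    rw [Complex.ofReal_pow, ← Complex.mul_conj', map_sum, Finset.sum_mul_sum]
    refine Finset.sum_congr rfl fun s _ => Finset.sum_congr rfl fun r _ => ?_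
    rw [map_mul, ← Complex.exp_conj, Complex.conj_ofReal, mul_mul_mul_comm, ← Complex.exp_add]
    congr 2
    simp only [map_mul, Complex.conj_I, Complex.conj_ofReal]
    push_cast; ring
  -- The spectral isometry: both sides expand into the same double sum of covariances.
  have heq : ∫ w, (∑ s ∈ I, c s * X s w) ^ 2 ∂P =
      ∫ l : ℝ, ‖∑ s ∈ I, (c s : ℂ) * Complex.exp (Complex.I * s * l)‖ ^ 2 ∂F := by
    rw [hX.integral_sum_sq]
    apply Complex.ofReal_injective
    rw [← integral_complex_ofReal]
    simp_rw [hnorm]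
    rw [integral_finsetSum _ fun s _ => integrable_finsetSum _ fun r _ => (hexp _).const_mul _]
    push_cast
    refine Finset.sum_congr rfl fun s _ => ?_
    rw [integral_finsetSum _ fun r _ => by simpa using (hexp (s - r)).const_mul _]
    refine Finset.sum_congr rfl fun r _ => ?_
    rw [integral_const_mul, hF]
    push_cast
    rfl
  rw [heq, hcov0]
  have h1 : ∫ l : ℝ, ‖∑ s ∈ I, (c s : ℂ) * Complex.exp (Complex.I * s * l)‖ ^ 2 ∂F ≤
      ∫ _ : ℝ, K ^ 2 ∂F := by
    refine integral_mono_of_nonneg (Eventually.of_forall fun l => by positivity)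
      (integrable_const _) ?_
    filter_upwards [hK] with l hl
    exact pow_le_pow_left₀ (norm_nonneg _) hl 2
  refine h1.trans_eq ?_
  rw [integral_const, smul_eq_mul, mul_comm]

end Stationary

/-- The times entering the truncation error at `t`. -/
noncomputable def samplingNodes (ω : ℝ) (n : ℕ) (t : ℝ) : Finset ℝ :=
  insert t ((Finset.Icc (-(n : ℤ)) (n : ℤ)).image fun k : ℤ => k * Real.pi / ω)

/-- The coefficients with which the values at the `samplingNodes` enter the truncation error. -/
noncomputable def samplingCoeff (ω : ℝ) (n : ℕ) (t s : ℝ) : ℝ :=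
  (if s = t then 1 else 0) - ∑ k ∈ Finset.Icc (-(n : ℤ)) (n : ℤ),
    if s = k * Real.pi / ω then Real.sinc (ω * (t - k * Real.pi / ω)) else 0

/-- If `t` coincides with a sampling point, the coefficients there add up. General `E` serves both
the process values and the complex exponentials. -/
lemma sum_samplingCoeff_smul {E : Type*} [AddCommGroup E] [Module ℝ E] (ω : ℝ) (n : ℕ) (t : ℝ)
    (g : ℝ → E) : ∑ s ∈ samplingNodes ω n t, samplingCoeff ω n t s • g s =
      g t - ∑ k ∈ Finset.Icc (-(n : ℤ)) (n : ℤ),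
        Real.sinc (ω * (t - k * Real.pi / ω)) • g (k * Real.pi / ω) := by
  simp_rw [samplingCoeff, sub_smul, Finset.sum_sub_distrib, Finset.sum_smul, ite_smul, zero_smul]
  rw [Finset.sum_comm]
  congr 1
  · rw [Finset.sum_ite_eq' , if_pos (by simp [samplingNodes]), one_smul]
  · refine Finset.sum_congr rfl fun k hk => ?_
    rw [Finset.sum_ite_eq', if_pos]
    exact Finset.mem_insert_of_mem (Finset.mem_image_of_mem _ hk)

lemma sub_truncatedSum_eq_sum {Ω : Type*} (X : ℝ → Ω → ℝ) (ω : ℝ)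
    (n : ℕ) (t : ℝ) (w : Ω) : X t w - truncatedSum X ω n t w =
      ∑ s ∈ samplingNodes ω n t, samplingCoeff ω n t s * X s w := by
  have h := sum_samplingCoeff_smul ω n t (fun s => X s w)
  simp only [smul_eq_mul] at h
  rw [h, truncatedSum]

section Bound

variable {Λ ω z t : ℝ} {n : ℕ}

/-- Here `n + 1 - x ≥ n(1 - √z)`, while `1 - z = (1 - √z)(1 + √z) ≤ 2(1 - √z)`. -/
lemma one_div_add_one_div_le {z x : ℝ} {n : ℕ} (hz₀ : 0 < z) (hz₁ : z < 1) (hn0 : 0 < n)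
    (hx0 : 0 ≤ x) (hx : x ≤ n * Real.sqrt z) :
    1 / (n + 1 - x) + 1 / (n + 1 + x) ≤ 3 / ((1 - z) * n) := by
  have hn : (0 : ℝ) < n := by exact_mod_cast hn0
  have hsq := Real.sq_sqrt hz₀.le
  have hs0 := Real.sqrt_nonneg z
  have hs1 : Real.sqrt z < 1 := by
    rw [← Real.sqrt_one]; exact Real.sqrt_lt_sqrt hz₀.le hz₁
  set s := Real.sqrt z
  have hd : 0 < (1 - z) * n := mul_pos (by linarith) hn
  have h1 : 1 / (n + 1 - x) ≤ 2 / ((1 - z) * n) := by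
    rw [div_le_div_iff₀ (by nlinarith) hd]
    nlinarith [mul_nonneg hn.le (sq_nonneg (1 - s))]
  have h2 : 1 / (n + 1 + x) ≤ 1 / ((1 - z) * n) := by
    apply one_div_le_one_div_of_le hd
    nlinarith
  refine (add_le_add h1 h2).trans_eq ?_
  rw [← add_div]; norm_num

lemma norm_sum_samplingCoeff_exp_le (hΛ : 0 < Λ) (hω : Λ < ω) (hz₀ : 0 < z) (hz₁ : z < 1)
    (hn0 : 0 < n) (ht : 0 ≤ t) (hn : ω * t / (Real.pi * Real.sqrt z) ≤ n) {l : ℝ} (hl : |l| ≤ Λ) :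
    ‖∑ s ∈ samplingNodes ω n t, (samplingCoeff ω n t s : ℂ) * Complex.exp (Complex.I * s * l)‖ ≤
      (4 * ω * t / (Real.pi ^ 2 * (1 - z)) +
        4 * (z + 1 + 1 / (n : ℝ)) / (Real.pi * (1 - z) ^ 2 * (1 - Λ / ω))) / n := by
  have hpi := Real.pi_pos
  have hω0 : 0 < ω := hΛ.trans hω
  have hnr : (0 : ℝ) < n := by exact_mod_cast hn0
  have hz1 : 0 < 1 - z := by linarith
  have hsz := Real.sqrt_pos.mpr hz₀
  have hL : 0 < 1 - Λ / ω := by rw [sub_pos, div_lt_one hω0]; exact hω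
  have hx0 : 0 ≤ ω * t / Real.pi := by positivity
  have hx : ω * t / Real.pi ≤ n * Real.sqrt z := by
    rw [div_le_iff₀ hpi]
    rw [div_le_iff₀ (by positivity)] at hn
    linarith
  have hs1 : Real.sqrt z < 1 := by
    rw [← Real.sqrt_one]; exact Real.sqrt_lt_sqrt hz₀.le hz₁
  have hxn : |ω * t / Real.pi| < n + 1 := by
    rw [abs_of_nonneg hx0]
    nlinarith
  have hθ0 : |Real.pi * l / ω| = Real.pi * (|l| / ω) := by
    rw [abs_div, abs_mul, abs_of_pos hpi, abs_of_pos hω0, mul_div_assoc]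
  have hlω : |l| / ω ≤ Λ / ω := by gcongr
  have hθ : |Real.pi * l / ω| < Real.pi := by
    rw [hθ0]
    nlinarith
  have hsum : ∑ s ∈ samplingNodes ω n t, (samplingCoeff ω n t s : ℂ) *
      Complex.exp (Complex.I * s * l) =
      Complex.exp (Complex.I * (ω * t / Real.pi : ℝ) * (Real.pi * l / ω : ℝ)) -
      ∑ k ∈ Finset.Icc (-(n : ℤ)) n, (Real.sinc (Real.pi * (ω * t / Real.pi - k)) : ℂ) *
        Complex.exp (Complex.I * k * (Real.pi * l / ω : ℝ)) := by
    have h := sum_samplingCoeff_smul ω n t (fun s : ℝ => Complex.exp (Complex.I * s * l))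
    simp only [Complex.real_smul] at h
    rw [h]
    have hpi' : (Real.pi : ℂ) ≠ 0 := by exact_mod_cast hpi.ne'
    have hω' : (ω : ℂ) ≠ 0 := by exact_mod_cast hω0.ne'
    congr 1
    · congr 1; push_cast; field_simp
    · refine Finset.sum_congr rfl fun k _ => ?_
      congr 2
      · congr 1; field_simp
      · push_cast; field_simp
  rw [hsum]
  refine (norm_exp_sub_sum_sinc_le n _ _ hxn hθ).trans ?_
  rw [hθ0, mul_div_cancel_left₀ _ hpi.ne']
  calc 1 / (Real.pi * (1 - |l| / ω)) *
        (1 / (n + 1 - ω * t / Real.pi) + 1 / (n + 1 + ω * t / Real.pi))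
      ≤ 1 / (Real.pi * (1 - Λ / ω)) * (3 / ((1 - z) * n)) := by
        refine mul_le_mul ?_ (one_div_add_one_div_le hz₀ hz₁ hn0 hx0 hx) ?_ (by positivity)
        · apply one_div_le_one_div_of_le (by positivity)
          gcongr
        · rw [abs_of_nonneg hx0] at hxn
          have : 0 < n + 1 - ω * t / Real.pi := by linarith
          positivity
    _ = (3 * (1 - z)) / (Real.pi * (1 - z) ^ 2 * (1 - Λ / ω)) / n := by
        field_simp
    -- There is room to spare: `3(1 - z) < 3 < 4(z + 1 + 1/n)`.
    _ ≤ (4 * (z + 1 + 1 / (n : ℝ)) / (Real.pi * (1 - z) ^ 2 * (1 - Λ / ω))) / n := by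
        have : 0 < 1 / (n : ℝ) := by positivity
        gcongr
        · linarith
        · linarith
    -- The term of `C_n` linear in `t` is pure slack.
    _ ≤ _ := by
        gcongr
        have : 0 ≤ 4 * ω * t / (Real.pi ^ 2 * (1 - z)) := by positivity
        linarith

/-- The mean square truncation error. -/
lemma integral_sub_truncatedSum_sq_le {Ω : Type*} [MeasurableSpace Ω] {P : Measure Ω}
    {X : ℝ → Ω → ℝ} (hΛ : 0 < Λ) (hω : Λ < ω) (hz₀ : 0 < z) (hz₁ : z < 1)
    (hn0 : 0 < n) (ht : 0 ≤ t) (hn : ω * t / (Real.pi * Real.sqrt z) ≤ n)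
    (hstat : IsCentredStationary P X) (hband : IsBandlimited P X Λ) :
    ∫ w, (∑ s ∈ samplingNodes ω n t, samplingCoeff ω n t s * X s w) ^ 2 ∂P ≤
      errorBound (covFun P X 0) ω Λ z n t / n ^ 2 := by
  obtain ⟨F, hF, hsupp, hcov⟩ := hband
  refine (hstat.integral_sum_sq_le hcov _ _ (K := (4 * ω * t / (Real.pi ^ 2 * (1 - z)) +
        4 * (z + 1 + 1 / (n : ℝ)) / (Real.pi * (1 - z) ^ 2 * (1 - Λ / ω))) / n) ?_).trans_eq ?_
  · have h1 : ∀ᵐ l : ℝ ∂F, l ∈ Set.Ico (-Λ) Λ := hsupp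
    filter_upwards [h1] with l hl
    exact norm_sum_samplingCoeff_exp_le hΛ hω hz₀ hz₁ hn0 ht hn
      (abs_le.mpr ⟨hl.1, hl.2.le⟩)
  · rw [errorBound]; ring

end Bound

/-! ### Tail bound for `L_p` functionals -/

/-- With `s = ax/p ≥ 1` and `r = u/x`, Bernoulli gives `s r^p ≤ r^(ps) + s - 1`, and `r ≤ exp(r -
1)` bounds `r^(ax)`. Only `ax ≥ p` is required, so `p < 1` is covered too. -/
lemma mul_div_rpow_le_exp_add {a u x p : ℝ} (hu : 0 ≤ u) (hx : 0 < x) (hp : 0 < p)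
    (hpa : p ≤ a * x) :
    a * x / p * (u / x) ^ p ≤ Real.exp (a * u - a * x) + (a * x / p - 1) := by
  have hr : 0 ≤ u / x := by positivity
  have hs : 1 ≤ a * x / p := by rwa [one_le_div hp]
  have h1 := one_add_mul_self_le_rpow_one_add (s := (u / x) ^ p - 1)
    (by linarith [Real.rpow_nonneg hr p]) hs
  rw [add_sub_cancel, ← Real.rpow_mul hr, mul_div_cancel₀ _ hp.ne'] at h1
  have h2 : (u / x) ^ (a * x) ≤ Real.exp (a * u - a * x) := by
    have h3 : u / x ≤ Real.exp (u / x - 1) := by linarith [Real.add_one_le_exp (u / x - 1)]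
    refine (Real.rpow_le_rpow hr h3 (hp.le.trans hpa)).trans_eq ?_
    rw [← Real.exp_mul]
    congr 1
    field_simp
  linarith

section Tail

variable {α Ω : Type*} [MeasurableSpace α] [MeasurableSpace Ω] {μ : Measure α} [SFinite μ]
  {P : Measure Ω} [SFinite P] {Y : α → Ω → ℝ} {σ : α → ℝ} {p : ℝ}

/-- If the `Y t / σ t` have a uniformly bounded exponential moment, then almost all paths of `Y`
are `p`-integrable. -/
lemma ae_integrable_abs_rpow_of_lintegral_exp_le (hp : 0 < p)
    (hY : AEMeasurable (Function.uncurry Y) (μ.prod P)) (hσ : ∀ᵐ t ∂μ, 0 < σ t)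
    (hint : Integrable (fun t => σ t ^ p) μ) {K : ℝ}
    (hK : ∀ᵐ t ∂μ, ∫⁻ w, ENNReal.ofReal (Real.exp (1 * (|Y t w| / σ t))) ∂P ≤ ENNReal.ofReal K) :
    ∀ᵐ w ∂P, Integrable (fun t => |Y t w| ^ p) μ := by
  have hYp : AEMeasurable (fun q : α × Ω => |Y q.1 q.2| ^ p) (μ.prod P) :=
    (hY.abs).pow_const p
  suffices h : Integrable (fun q : α × Ω => |Y q.1 q.2| ^ p) (μ.prod P) from h.prod_left_ae
  refine ⟨hYp.aestronglyMeasurable, ?_⟩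
  rw [hasFiniteIntegral_iff_ofReal (Eventually.of_forall fun q => by positivity),
    lintegral_prod _ hYp.ennreal_ofReal]
  have hb : ∀ᵐ t ∂μ, ∫⁻ w, ENNReal.ofReal (|Y t w| ^ p) ∂P ≤
      ENNReal.ofReal (p ^ p * Real.exp (-p) * σ t ^ p) * ENNReal.ofReal K := by
    filter_upwards [hσ, hK] with t ht hKt
    refine le_trans ?_ (mul_le_mul_right hKt _)
    rw [← lintegral_const_mul' _ _ ENNReal.ofReal_ne_top]
    refine lintegral_mono fun w => ?_
    rw [← ENNReal.ofReal_mul (by positivity)]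
    refine ENNReal.ofReal_le_ofReal ?_
    -- With `a = 1` and `x = p` the factor `ax/p` is 1 and the additive term vanishes.
    have h1 := mul_div_rpow_le_exp_add (a := 1) (u := |Y t w| / σ t) (x := p) (p := p)
      (by positivity) hp hp (by simp)
    rw [one_mul p, div_self hp.ne', one_mul, sub_self, add_zero, div_div,
      Real.div_rpow (abs_nonneg _) (by positivity), Real.mul_rpow ht.le hp.le,
      div_le_iff₀ (by positivity), sub_eq_add_neg, Real.exp_add] at h1
    refine h1.trans_eq ?_
    ring
  refine (lintegral_mono_ae hb).trans_lt ?_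
  rw [lintegral_mul_const' _ _ ENNReal.ofReal_ne_top]
  exact ENNReal.mul_lt_top (hint.const_mul _).lintegral_lt_top ENNReal.ofReal_lt_top

/-- A tail bound for the `L_p` functional of a process whose normalized values have bounded
exponential moments. -/
lemma measure_lt_integral_abs_rpow_le (hp : 0 < p)
    (hY : AEMeasurable (Function.uncurry Y) (μ.prod P)) (hσm : Measurable σ)
    (hσ : ∀ᵐ t ∂μ, 0 < σ t) (hint : Integrable (fun t => σ t ^ p) μ)
    (hc : 0 < ∫ t, σ t ^ p ∂μ) {a x K : ℝ} (hx : 0 < x) (hpa : p ≤ a * x) (hK0 : 0 ≤ K)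
    (hK : ∀ᵐ t ∂μ, ∫⁻ w, ENNReal.ofReal (Real.exp (a * (|Y t w| / σ t))) ∂P ≤ ENNReal.ofReal K) :
    P {w | (∫ t, σ t ^ p ∂μ) * x ^ p < ∫ t, |Y t w| ^ p ∂μ} ≤
      ENNReal.ofReal (K * Real.exp (-(a * x))) := by
  set c := ∫ t, σ t ^ p ∂μ
  have hs : 1 ≤ a * x / p := by rwa [one_le_div hp]
  set s := a * x / p
  have hxp : 0 < x ^ p := Real.rpow_pos_of_pos hx p
  set h : α × Ω → ENNReal := fun q =>
    ENNReal.ofReal (σ q.1 ^ p * Real.exp (a * (|Y q.1 q.2| / σ q.1) - a * x))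
  have hm : AEMeasurable h (μ.prod P) := by
    have hσ1 : Measurable fun q : α × Ω => σ q.1 := hσm.comp measurable_fst
    have hY1 : AEMeasurable (fun q : α × Ω => |Y q.1 q.2|) (μ.prod P) := hY.abs
    exact ((hσ1.pow_const p).aemeasurable.mul
      (((hY1.div hσ1.aemeasurable).const_mul a).sub_const _).exp).ennreal_ofReal
  have hc_eq : ∀ k : ℝ, 0 ≤ k → ∫⁻ t, ENNReal.ofReal (k * σ t ^ p) ∂μ = ENNReal.ofReal (k * c) := by
    intro k hk
    rw [← integral_const_mul, ofReal_integral_eq_lintegral_ofReal (hint.const_mul k)]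
    filter_upwards [hσ] with t ht
    simp only [Pi.zero_apply]
    positivity
  have hsub : {w | c * x ^ p < ∫ t, |Y t w| ^ p ∂μ} ⊆
      {w | ENNReal.ofReal c ≤ ∫⁻ t, h (t, w) ∂μ} := by
    intro w hw
    simp only [Set.mem_ofPred_eq] at hw ⊢
    -- A non-integrable path has integral 0 by convention, hence lies outside the event.
    have hYint : Integrable (fun t => |Y t w| ^ p) μ := by
      by_contra hni
      rw [integral_undef hni] at hw
      have : 0 < c * x ^ p := by positivity
      linarith
    -- Only the deterministic summand must be measurable to split the integral, so this holds for
    -- every `w` in the event.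
    have h1 : ENNReal.ofReal (s / x ^ p * ∫ t, |Y t w| ^ p ∂μ) ≤
        ∫⁻ t, h (t, w) ∂μ + ENNReal.ofReal ((s - 1) * c) := by
      rw [← hc_eq _ (by linarith), ← integral_const_mul,
        ofReal_integral_eq_lintegral_ofReal (hYint.const_mul _)
          (Eventually.of_forall fun t => by simp only [Pi.zero_apply]; positivity),
        ← lintegral_add_right _ ((hσm.pow_const p).const_mul _).ennreal_ofReal]
      refine lintegral_mono_ae ?_
      filter_upwards [hσ] with t ht
      have hσp : 0 < σ t ^ p := Real.rpow_pos_of_pos ht p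
      have hs' : 0 ≤ s - 1 := by linarith
      simp only [h]
      rw [← ENNReal.ofReal_add (by positivity) (by positivity)]
      refine ENNReal.ofReal_le_ofReal ?_
      have h2 := mul_div_rpow_le_exp_add (a := a) (u := |Y t w| / σ t) (x := x) (p := p)
        (by positivity) hx hp hpa
      rw [div_div, Real.div_rpow (abs_nonneg _) (by positivity), Real.mul_rpow ht.le hx.le] at h2
      have h3 := mul_le_mul_of_nonneg_left h2 hσp.le
      calc s / x ^ p * |Y t w| ^ p = σ t ^ p * (a * x / p * (|Y t w| ^ p / (σ t ^ p * x ^ p))) := by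
            simp only [s]; field_simp
        _ ≤ _ := h3
        _ = _ := by ring
    have h4 : ENNReal.ofReal c + ENNReal.ofReal ((s - 1) * c) ≤
        ∫⁻ t, h (t, w) ∂μ + ENNReal.ofReal ((s - 1) * c) := by
      refine le_trans ?_ h1
      rw [← ENNReal.ofReal_add hc.le (mul_nonneg (by linarith) hc.le)]
      refine ENNReal.ofReal_le_ofReal ?_
      have h5 : s / x ^ p * (c * x ^ p) ≤ s / x ^ p * ∫ t, |Y t w| ^ p ∂μ :=
        mul_le_mul_of_nonneg_left hw.le (by positivity)
      refine le_trans (le_of_eq ?_) h5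
      field_simp
      ring
    exact (ENNReal.add_le_add_iff_right ENNReal.ofReal_ne_top).mp h4
  have hmG : AEMeasurable (fun w => ∫⁻ t, h (t, w) ∂μ) P := hm.prod_swap.lintegral_prod_right'
  refine (measure_mono hsub).trans ((meas_ge_le_lintegral_div hmG
    (ENNReal.ofReal_pos.mpr hc).ne' ENNReal.ofReal_ne_top).trans ?_)
  refine ENNReal.div_le_of_le_mul ?_
  rw [← lintegral_prod_symm _ hm, lintegral_prod _ hm,
    ← ENNReal.ofReal_mul (by positivity), ← hc_eq _ (by positivity)]
  refine lintegral_mono_ae ?_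
  filter_upwards [hσ, hK] with t ht hKt
  calc ∫⁻ w, h (t, w) ∂P = ∫⁻ w, ENNReal.ofReal (σ t ^ p * Real.exp (-(a * x))) *
        ENNReal.ofReal (Real.exp (a * (|Y t w| / σ t))) ∂P := by
        refine lintegral_congr fun w => ?_
        simp only [h]
        rw [← ENNReal.ofReal_mul (by positivity), sub_eq_add_neg, Real.exp_add]
        congr 1; ring
    _ = ENNReal.ofReal (σ t ^ p * Real.exp (-(a * x))) *
        ∫⁻ w, ENNReal.ofReal (Real.exp (a * (|Y t w| / σ t))) ∂P :=
        lintegral_const_mul' _ _ ENNReal.ofReal_ne_top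
    _ ≤ ENNReal.ofReal (σ t ^ p * Real.exp (-(a * x))) * ENNReal.ofReal K := by gcongr
    _ = _ := by
        rw [← ENNReal.ofReal_mul (by positivity)]
        congr 1; ring

end Tail

/-- If `f y₀ ≤ x`, the function `y ↦ x y - φ y` takes its supremum on `[y₀, ∞)`. -/
lemma IsDensity.exists_ge_mul_sub_le {φ f : ℝ → ℝ} (hφ : IsOrliczNFunction φ)
    (hf : IsDensity φ f) {x y₀ : ℝ} (hx : 0 ≤ x) (hy₀ : 0 ≤ y₀) (hfx : f y₀ ≤ x) (y : ℝ) :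
    ∃ a, y₀ ≤ a ∧ x * y - φ y ≤ x * a - φ a := by
  have key : ∀ y, 0 ≤ y → y ≤ y₀ → x * y - φ y ≤ x * y₀ - φ y₀ := by
    intro y hy hyy
    have hii : ∀ u v, 0 ≤ u → 0 ≤ v → IntervalIntegrable f volume u v := fun u v hu hv =>
      (hf.monotoneOn.mono fun z hz => (le_min hu hv).trans hz.1).intervalIntegrable
    have h1 : φ y₀ - φ y = ∫ v in y..y₀, f v := by
      rw [hf.eq_integral y₀, hf.eq_integral y, abs_of_nonneg hy, abs_of_nonneg hy₀,
        intervalIntegral.integral_interval_sub_left (hii 0 y₀ le_rfl hy₀) (hii 0 y le_rfl hy)]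
    have h2 := intervalIntegral.integral_mono_on (μ := volume) hyy (hii y y₀ hy hy₀)
      (intervalIntegrable_const (c := x))
      (fun v hv => (hf.monotoneOn (hy.trans hv.1) hy₀ hv.2).trans hfx)
    rw [intervalIntegral.integral_const, smul_eq_mul] at h2
    linarith
  rcases le_total y₀ y with h | h
  · exact ⟨y, h, le_rfl⟩
  · refine ⟨y₀, le_rfl, ?_⟩
    rcases le_total 0 y with hy | hy
    · exact key y hy h
    · have h1 := key 0 le_rfl hy₀
      rw [hφ.map_zero] at h1
      nlinarith [hφ.nonneg y]

/-- Logarithms turn the bounds for all `y` into one upper bound for the supremum; `r = 0` is set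
apart because its logarithm is meaningless. -/
lemma le_mul_exp_neg_youngFenchel {φ : ℝ → ℝ} {r K x : ℝ} (hr : 0 ≤ r) (hK : 0 < K)
    (h : ∀ y, r ≤ K * Real.exp (-(x * y - φ y))) : r ≤ K * Real.exp (-youngFenchel φ x) := by
  rcases hr.eq_or_lt with rfl | hr
  · positivity
  have h1 : youngFenchel φ x ≤ -Real.log (r / K) := by
    refine ciSup_le fun y => ?_
    have h2 : Real.log (r / K) ≤ -(x * y - φ y) := by
      rw [Real.log_le_iff_le_exp (by positivity), div_le_iff₀ hK, mul_comm]
      exact h y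
    linarith
  have h3 : Real.log (r / K) ≤ -youngFenchel φ x := by linarith
  rw [Real.log_le_iff_le_exp (by positivity), div_le_iff₀ hK, mul_comm] at h3
  exact h3

/-! ### Measurability and scale of the truncation error; conclusion -/

section Error

variable {Ω : Type*} [MeasurableSpace Ω] {P : Measure Ω}

lemma aemeasurable_sub_truncatedSum [SFinite P] {X : ℝ → Ω → ℝ}
    (hX : AEMeasurable (Function.uncurry X) ((volume : Measure ℝ).prod P))
    (hXt : ∀ t, AEMeasurable (X t) P) (ω : ℝ) (n : ℕ) (s : Set ℝ) :
    AEMeasurable (Function.uncurry fun t w => X t w - truncatedSum X ω n t w)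
      ((volume.restrict s).prod P) := by
  have h1 : AEMeasurable (Function.uncurry X) ((volume.restrict s).prod P) :=
    hX.mono_ac (Measure.restrict_le_self.absolutelyContinuous.prod Measure.AbsolutelyContinuous.rfl)
  have h2 : AEMeasurable (fun q : ℝ × Ω => ∑ k ∈ Finset.Icc (-(n : ℤ)) (n : ℤ),
      Real.sinc (ω * (q.1 - k * Real.pi / ω)) * X (k * Real.pi / ω) q.2)
      ((volume.restrict s).prod P) := by
    refine Finset.aemeasurable_fun_sum _ fun k _ => AEMeasurable.mul ?_ ?_
    · have h4 : Measurable fun t : ℝ => Real.sinc (ω * (t - k * Real.pi / ω)) :=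
        (Real.continuous_sinc.comp (by fun_prop)).measurable
      exact (h4.comp measurable_fst).aemeasurable
    · exact (hXt _).comp_snd
  exact h1.sub h2

variable {ω Λ z T p B C t : ℝ} {n : ℕ}

lemma continuous_errorBound (B ω Λ z : ℝ) (n : ℕ) : Continuous (errorBound B ω Λ z n) := by
  unfold errorBound
  fun_prop

lemma errorBound_nonneg (hB : 0 ≤ B) (t : ℝ) : 0 ≤ errorBound B ω Λ z n t :=
  mul_nonneg hB (sq_nonneg _)

lemma errorBound_pos (hB : 0 < B) (hΛ : 0 < Λ) (hω : Λ < ω) (hz₀ : 0 < z) (hz₁ : z < 1)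
    (ht : 0 ≤ t) : 0 < errorBound B ω Λ z n t := by
  have hpi := Real.pi_pos
  have hω0 := hΛ.trans hω
  have hL : 0 < 1 - Λ / ω := by rw [sub_pos, div_lt_one hω0]; exact hω
  have hz : 0 < 1 - z := by linarith
  unfold errorBound
  positivity

/-- This puts `S_{n,p}` in the form `∫ σ^p` used by the tail bound. -/
lemma errorScale_eq (hC : 0 ≤ C) (hB : 0 ≤ B) (hT : 0 ≤ T) :
    errorScale C B ω Λ z T p n =
      ∫ t in Set.Icc 0 T, (C / n * Real.sqrt (errorBound B ω Λ z n t)) ^ p := by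
  rw [errorScale, intervalIntegral.integral_of_le hT, ← integral_Icc_eq_integral_Ioc,
    ← integral_const_mul]
  congr 1 with t
  rw [Real.mul_rpow (by positivity) (Real.sqrt_nonneg _), Real.sqrt_eq_rpow,
    ← Real.rpow_mul (errorBound_nonneg hB t)]
  congr 2; ring

lemma integrable_rpow_of_continuous {σ : ℝ → ℝ} (hσ : Continuous σ) (hp : 0 ≤ p) (T : ℝ) :
    Integrable (fun t => σ t ^ p) (volume.restrict (Set.Icc 0 T)) :=
  ((hσ.rpow_const fun _ => Or.inr hp).integrableOn_Icc)

lemma setIntegral_Icc_pos {g : ℝ → ℝ} (hT : 0 < T) (hg : IntegrableOn g (Set.Icc 0 T))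
    (hpos : ∀ t ∈ Set.Icc 0 T, 0 < g t) : 0 < ∫ t in Set.Icc 0 T, g t := by
  rw [setIntegral_pos_iff_support_of_nonneg_ae _ hg]
  · have h1 : Function.support g ∩ Set.Icc 0 T = Set.Icc 0 T :=
      Set.inter_eq_right.mpr fun t ht => (hpos t ht).ne'
    rw [h1, Real.volume_Icc]
    simpa using hT
  · filter_upwards [ae_restrict_mem measurableSet_Icc] with t ht using (hpos t ht).le

end Error

theorem theorem3 {Ω : Type*} [MeasurableSpace Ω] (P : Measure Ω) [IsProbabilityMeasure P]
    (φ f : ℝ → ℝ) (hφ : IsOrliczNFunction φ) (hQ : ConditionQ φ) (hf : IsDensity φ f)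
    (X : ℝ → Ω → ℝ)
    (hX : AEMeasurable (Function.uncurry X) ((volume : Measure ℝ).prod P))
    (C Λ ω z T p : ℝ) (n : ℕ)
    (hΛ : 0 < Λ) (hω : Λ < ω) (hz₀ : 0 < z) (hz₁ : z < 1) (hT : 0 < T) (hp : 0 < p)
    (hn : ∀ t ∈ Set.Icc 0 T, ω * t / (Real.pi * Real.sqrt z) ≤ n)
    (hstat : IsCentredStationary P X) (hband : IsBandlimited P X Λ)
    (hsub : IsSSubWith φ P X C) :
    (∀ᵐ w ∂P, IntegrableOn (fun t => |X t w - truncatedSum X ω n t w| ^ p) (Set.Icc 0 T)) ∧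
    ∀ ε : ℝ, 0 < ε →
      errorScale C (covFun P X 0) ω Λ z T p n *
          f (p * (errorScale C (covFun P X 0) ω Λ z T p n / ε) ^ (1 / p)) ^ p < ε →
      P.real {w | ε < ∫ t in (0 : ℝ)..T, |X t w - truncatedSum X ω n t w| ^ p} ≤
        2 * Real.exp
          (-youngFenchel φ ((ε / errorScale C (covFun P X 0) ω Λ z T p n) ^ (1 / p))) := by
  have hω0 := hΛ.trans hω
  have hC : 0 < C := hsub.2.1
  -- Positivity of `n` is forced by the sampling condition at `t = T`.
  have hn0 : 0 < n := by
    have h1 := hn T ⟨hT.le, le_rfl⟩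
    have h2 : 0 < ω * T / (Real.pi * Real.sqrt z) := by
      have := Real.pi_pos
      have := Real.sqrt_pos.mpr hz₀
      positivity
    exact_mod_cast h2.trans_le h1
  have hB : 0 ≤ covFun P X 0 := integral_nonneg fun w => mul_self_nonneg _
  set B := covFun P X 0
  set σ : ℝ → ℝ := fun t => C / n * Real.sqrt (errorBound B ω Λ z n t)
  have hσc : Continuous σ :=
    continuous_const.mul (Real.continuous_sqrt.comp (continuous_errorBound B ω Λ z n))
  have hσ0 : ∀ t, 0 ≤ σ t := fun t => by positivity
  have hY := aemeasurable_sub_truncatedSum hX (fun t => (hsub.1 t).1.aemeasurable) ω n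
    (Set.Icc 0 T)
  -- Any scale `s ≥ σ t` is allowed because `σ` itself vanishes when `B(0) = 0`.
  have hmom : ∀ t ∈ Set.Icc 0 T, ∀ s : ℝ, σ t ≤ s → 0 < s → ∀ a : ℝ,
      ∫⁻ w, ENNReal.ofReal (Real.exp (a * (|X t w - truncatedSum X ω n t w| / s))) ∂P ≤
        ENNReal.ofReal (2 * Real.exp (φ a)) := by
    intro t ht s hs hs0 a
    simp_rw [sub_truncatedSum_eq_sum]
    refine hsub.lintegral_exp_abs_le hφ _ _ hs0 (le_trans ?_ hs) a
    have h1 := Real.sqrt_le_sqrt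
      (integral_sub_truncatedSum_sq_le hΛ hω hz₀ hz₁ hn0 ht.1 (hn t ht) hstat hband)
    rw [Real.sqrt_div' _ (by positivity), Real.sqrt_sq (by positivity)] at h1
    refine (mul_le_mul_of_nonneg_left h1 hC.le).trans_eq ?_
    simp only [σ]
    ring
  constructor
  -- The scale `σ + 1` is positive even in the degenerate case.
  · refine ae_integrable_abs_rpow_of_lintegral_exp_le (σ := fun t => σ t + 1) hp hY
      (Eventually.of_forall fun t => by linarith [hσ0 t])
      (integrable_rpow_of_continuous (hσc.add continuous_const) hp.le T)
      (K := 2 * Real.exp (φ 1)) ?_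
    filter_upwards [ae_restrict_mem measurableSet_Icc] with t ht
    exact hmom t ht _ (by linarith) (by linarith [hσ0 t]) 1
  · intro ε hε hεS
    rw [errorScale_eq hC.le hB hT.le] at hεS ⊢
    change (∫ t in Set.Icc 0 T, σ t ^ p) * _ < ε at hεS
    change _ ≤ 2 * Real.exp (-youngFenchel φ ((ε / ∫ t in Set.Icc 0 T, σ t ^ p) ^ (1 / p)))
    refine le_mul_exp_neg_youngFenchel measureReal_nonneg two_pos fun y => ?_
    -- If `B(0) = 0`, then `ε / 0 = 0` makes the argument of `φ*` zero, and the claim for each `y`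
    -- is weaker than `P ≤ 1`.
    rcases hB.eq_or_lt with hB0 | hB0
    · have hσz : ∀ t, σ t = 0 := fun t => by simp [σ, errorBound, ← hB0]
      simp only [hσz, Real.zero_rpow hp.ne', integral_zero, div_zero,
        Real.zero_rpow (one_div_pos.mpr hp).ne', zero_mul, zero_sub, neg_neg]
      have h1 : 1 ≤ Real.exp (φ y) := Real.one_le_exp (hφ.nonneg y)
      have h2 := measureReal_le_one (μ := P)
        (s := {w | ε < ∫ t in (0 : ℝ)..T, |X t w - truncatedSum X ω n t w| ^ p})
      linarith
    have hσpos : ∀ t ∈ Set.Icc 0 T, 0 < σ t := fun t ht => by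
      have h1 := errorBound_pos (n := n) hB0 hΛ hω hz₀ hz₁ ht.1
      have h2 : (0 : ℝ) < n := by exact_mod_cast hn0
      positivity
    have hσi := integrable_rpow_of_continuous hσc hp.le T
    have hS : 0 < ∫ t in Set.Icc 0 T, σ t ^ p :=
      setIntegral_Icc_pos hT hσi fun t ht => Real.rpow_pos_of_pos (hσpos t ht) p
    set S := ∫ t in Set.Icc 0 T, σ t ^ p
    have hx : 0 < (ε / S) ^ (1 / p) := by positivity
    have hinv : (S / ε) ^ (1 / p) = ((ε / S) ^ (1 / p))⁻¹ := by
      rw [← Real.inv_rpow (by positivity), inv_div]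
    have hxp : ((ε / S) ^ (1 / p)) ^ p = ε / S := by
      rw [← Real.rpow_mul (by positivity), one_div_mul_cancel hp.ne', Real.rpow_one]
    rw [hinv] at hεS
    set x := (ε / S) ^ (1 / p)
    have hSx : S * x ^ p = ε := by rw [hxp, mul_div_cancel₀ _ hS.ne']
    have hfx : f (p * x⁻¹) ≤ x := by
      rw [← hSx] at hεS
      have h1 := lt_of_mul_lt_mul_left hεS hS.le
      by_contra! h2
      exact absurd (Real.rpow_le_rpow hx.le h2.le hp.le) (not_le.mpr h1)
    -- The threshold `y₀ = p/x` is exactly what makes `ax ≥ p`, the condition for Bernoulli's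
    -- inequality.
    obtain ⟨a, ha, hya⟩ := hf.exists_ge_mul_sub_le hφ hx.le (by positivity) hfx y
    have hpa : p ≤ a * x := by
      have h1 := mul_le_mul_of_nonneg_right ha hx.le
      rwa [inv_mul_cancel_right₀ hx.ne'] at h1
    have htail := measure_lt_integral_abs_rpow_le hp hY hσc.measurable
      ((ae_restrict_mem measurableSet_Icc).mono fun t ht => hσpos t ht) hσi hS hx hpa
      (K := 2 * Real.exp (φ a)) (by positivity)
      ((ae_restrict_mem measurableSet_Icc).mono fun t ht => hmom t ht _ le_rfl (hσpos t ht) a)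
    simp only [intervalIntegral.integral_of_le hT.le, ← integral_Icc_eq_integral_Ioc]
    change P {w | S * x ^ p < _} ≤ _ at htail
    rw [hSx] at htail
    refine (ENNReal.toReal_le_of_le_ofReal (by positivity) htail).trans ?_
    rw [mul_assoc, ← Real.exp_add]
    gcongr
    linarith
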